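/- Conventions. A decorated permutation on $n$ letters is a permutation $w$ of $[n]=\{1,\dots,n\}$ whose fixed points are coloured black or white; an antiexcedance of $w$ is an $i\in[n]$ such that $w^{-1}(i)>i$ or $i$ is a white fixed point. For $n\ge 3$ and $1\le k\le n-1$ let $\pi_{k,n}=(k+1,\dots,n,1,\dots,k)$ in one-line notation. For permutations $\sigma$ on $n_\sigma\ge2$ and $\tau$ on $n_\tau\ge 2$ letters, the amalgamation $\sigma\star\tau$ on $n_\sigma+n_\tau-2$ letters is defined as follows: for $1\le i\le n_\sigma-1$, $(\sigma\star\tau)(i)=\sigma(i)$ if $\sigma(i)\ne n_\sigma$, and $(\sigma\star\tau)(i)=\tau(1)+n_\sigma-2$ if $\sigma(i)=n_\sigma$; for $n_\sigma\le i\le n_\sigma+n_\tau-2$ and $i'=i-n_\sigma+2$, $(\sigma\star\tau)(i)=\tau(i')+n_\sigma-2$ if $\tau(i')\ne1$, and $(\sigma\star\tau)(i)=\sigma(n_\sigma)$ if $\tau(i')=1$. The cyclic rotation of $\pi$ is $\mathrm{cyc}(\pi)(i)=\pi(i-1)+1$ (modulo $n$). A Grassmannian tree permutation is a permutation that can be built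 from the $\pi_{k,n}$ with $n\ge3$, $1\le k\le n-1$, by amalgamations and cyclic rotations; in addition, the permutation $(1)$ on one letter (with its fixed point coloured black or white, which gives two decorated permutations) and the permutation $(2,1)$ are Grassmannian tree permutations. A Grassmannian tree is a finite tree embedded in a disk (up to isotopy) with $n\ge 1$ degree-one boundary vertices $b_1,\dots,b_n$ on the boundary of the disk, labelled in clockwise order, and with no vertex of degree $2$, in which each internal vertex $v$ carries an integer helicity $h(v)$ with $1\le h(v)\le\deg(v)-1$, or $h(v)\in\{0,1\}$ if $v$ has degree $1$ and is joined to a boundary vertex. Its decorated trip permutation $w_T$ sends $i$ to $j$ if the trip starting at $b_i$ ends at $b_j$, where a trip that enters an internal vertex $v$ through the edge $a_i$ (the edges $a_1,\dots,a_d$ at $v$ being labelled in clockwise order) leaves it through $a_{i+h(v)}$ (indices modulo $d$); a fixed point $i$ is white if the leaf joined to $b_i$ has helicity $1$ and black if it has helicity $0$. The mom-dimension of $T$ is $n-1$ if $n\le2$, and $1+\sum_v (m(v)-1)$ otherwise, the sum being over the internal vertices $v$, where $m(v)=\deg(v)-1$ if $h(v)\in\{1,\deg(v)-1\}$ and $m(v)=2\deg(v)-4$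 otherwise. The mom-dimension of a Grassmannian tree permutation $w$ is the mom-dimension of a Grassmannian tree $T$ with $w_T=w$. Corollary (Grassmannian tree permutations). The mom-dimension of a Grassmannian tree permutation is well defined: such a tree $T$ exists and its mom-dimension depends only on $w$. For all $n,k,r\ge0$, the number of Grassmannian tree permutations on $n$ letters with $k$ antiexcedances and mom-dimension $r$ equals $[x^ny^kq^r]\,\mathcal G_{\mathrm{tree}}(x,y,q)$, where $$\mathcal G_{\mathrm{tree}}(x,y,q)=x\left(1+y+yq\,C^{\langle-1\rangle}(x,y,q)\right),$$ $$C(x,y,q)=\frac{x\left(1-x(1+y)q^2-x^2yq^2(1+q-q^2)-x^4y^2q^5(1+q)\right)}{(1+xq)(1+xyq)(1-xq^2)(1-xyq^2)},$$ and $C^{\langle-1\rangle}$ is the compositional inverse of $C$ with respect to $x$. -/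

import Mathlib

namespace GrassmannianTree

/-! ### Decorated permutations -/

/-- A decorated permutation on `n` letters: a permutation of `Fin n` (the letters `1, …, n` are
`0, …, n - 1` here) whose fixed points are coloured black or white; `white` is the set of the
fixed points that are coloured white, the other fixed points are black. -/
@[ext]
structure DecoratedPerm (n : ℕ) where
  perm : Equiv.Perm (Fin n)
  white : Finset (Fin n)
  white_fixed : ∀ i ∈ white, perm i = i

instance (n : ℕ) : Finite (DecoratedPerm n) :=
  Finite.of_injective (fun w : DecoratedPerm n => (w.perm, w.white)) (by
    intro v w h
    simp only [Prod.mk.injEq] at h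
    exact DecoratedPerm.ext h.1 h.2)

/-- The antiexcedances of a decorated permutation `w`: the letters `i` with `w⁻¹(i) > i`,
together with the white fixed points. -/
def DecoratedPerm.antiexcedances {n : ℕ} (w : DecoratedPerm n) : Finset (Fin n) :=
  Finset.univ.filter (fun i => i < w.perm⁻¹ i ∨ i ∈ w.white)

/-! ### Grassmannian tree permutations -/

/-- The permutation `π_{k,n} = (k+1, …, n, 1, …, k)` in one-line notation. -/
def grassPerm (k n : ℕ) (i : Fin n) : Fin n :=
  ⟨(i.val + k) % n, Nat.mod_lt _ (Nat.lt_of_le_of_lt (Nat.zero_le _) i.isLt)⟩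

/-- The amalgamation `σ ⋆ τ` of `σ` on `n_σ = m + 2` letters and `τ` on `n_τ = n + 2` letters,
on `n_σ + n_τ - 2 = m + n + 2` letters. The last letter of `σ` is merged with the first letter of
`τ`, and the remaining letters of `τ` are shifted up by `n_σ - 2 = m`, in positions as well as in
values. Permutations are written in one-line notation, that is, as self-maps. -/
def amalgamate {m n : ℕ} (σ : Fin (m + 2) → Fin (m + 2)) (τ : Fin (n + 2) → Fin (n + 2))
    (i : Fin (m + n + 2)) : Fin (m + n + 2) :=
  if h : i.val < m + 1 then
    if σ ⟨i.val, by omega⟩ = Fin.last (m + 1) then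
      ⟨(τ 0).val + m, by have := (τ 0).isLt; omega⟩
    else
      ⟨(σ ⟨i.val, by omega⟩).val, by have := (σ ⟨i.val, by omega⟩).isLt; omega⟩
  else
    if τ ⟨i.val - m, by omega⟩ = 0 then
      ⟨(σ (Fin.last (m + 1))).val, by have := (σ (Fin.last (m + 1))).isLt; omega⟩
    else
      ⟨(τ ⟨i.val - m, by omega⟩).val + m, by have := (τ ⟨i.val - m, by omega⟩).isLt; omega⟩

/-- The cyclic rotation `cyc(π)(i) = π(i - 1) + 1`, modulo `n`. -/
def cyc {n : ℕ} (π : Fin n → Fin n) (i : Fin n) : Fin n :=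
  finRotate n (π ((finRotate n).symm i))

/-- The permutations that are built from the `π_{k,n}` with `n ≥ 3` and `1 ≤ k ≤ n - 1` by
amalgamations and cyclic rotations. -/
inductive IsBuilt : {n : ℕ} → (Fin n → Fin n) → Prop
  | grassPerm (k n : ℕ) (hn : 3 ≤ n) (hk : 1 ≤ k) (hkn : k ≤ n - 1) :
      IsBuilt (GrassmannianTree.grassPerm k n)
  | amalgamate {m n : ℕ} (σ : Fin (m + 2) → Fin (m + 2)) (τ : Fin (n + 2) → Fin (n + 2)) :
      IsBuilt σ → IsBuilt τ → IsBuilt (GrassmannianTree.amalgamate σ τ)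
  | cyc {n : ℕ} (π : Fin n → Fin n) : IsBuilt π → IsBuilt (GrassmannianTree.cyc π)

/-- Grassmannian tree permutations: the (black or white) decorated permutations on one letter,
the permutation `(2,1)`, and the permutations built from the `π_{k,n}`, `n ≥ 3`. -/
inductive IsGrassmannianTreePerm : {n : ℕ} → DecoratedPerm n → Prop
  | one (w : DecoratedPerm 1) : IsGrassmannianTreePerm w
  | two (w : DecoratedPerm 2) : w.perm = Equiv.swap 0 1 → IsGrassmannianTreePerm w
  | built {n : ℕ} (w : DecoratedPerm n) : IsBuilt (w.perm : Fin n → Fin n) →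
      IsGrassmannianTreePerm w

/-! ### Grassmannian trees

A tree embedded in a disk, whose leaves on the boundary are `b_1, …, b_n` in clockwise order, is
encoded by cutting it open at `b_1`. It is then an ordered rooted tree that hangs from `b_1` by its
root edge: below every edge there is either a boundary vertex (`leaf`) or an internal vertex, whose
further edges are listed in clockwise order starting from the edge towards `b_1`. The remaining
boundary vertices `b_2, …, b_n` are the leaves, from first to last. -/

/-- The part of a decorated embedded tree that hangs below an edge: a boundary vertex, or an
internal vertex `node h m c` of helicity `h` and degree `m + 1`, with `m` further edges. -/
inductive PlaneTree : Type
  | leaf : PlaneTree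
  | node (h m : ℕ) (c : Fin m → PlaneTree) : PlaneTree

namespace PlaneTree

/-- Every internal vertex has degree at least `3` and helicity between `1` and the degree
minus `1`. -/
def IsProper : PlaneTree → Prop
  | leaf => True
  | node h m c => 2 ≤ m ∧ 1 ≤ h ∧ h ≤ m ∧ ∀ i, (c i).IsProper

/-- The Grassmannian trees: either `b_1` is joined to a boundary leaf (an internal vertex of degree
`1`), which has helicity `0` or `1`, or all internal vertices have degree at least `3` and helicity
between `1` and the degree minus `1`. The edge that joins two boundary vertices is included. -/
def IsGrassmannian (T : PlaneTree) : Prop :=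
  (∃ h c, h ≤ 1 ∧ T = node h 0 c) ∨ T.IsProper

/-- An edge is addressed by the path that leads to it from the root edge `[]`: if the edge `a` has
an internal vertex at its lower end, `a ++ [i]` is the `i`-th of the further edges of that vertex.
The vertex at the lower end of the edge `a` has the same address. -/
abbrev Address := List ℕ

/-- The part of the tree below the edge at a given address. -/
def subtreeAt : PlaneTree → Address → Option PlaneTree
  | T, [] => some T
  | leaf, _ :: _ => none
  | node _ m c, i :: a => if hi : i < m then (c ⟨i, hi⟩).subtreeAt a else none

/-- The addresses of the edges at the boundary vertices `b_2, …, b_n`, in clockwise order. -/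
def leaves : PlaneTree → List Address
  | leaf => [[]]
  | node _ m c => (List.finRange m).flatMap (fun i => (c i).leaves.map (fun a => i.val :: a))

/-- The number `n` of boundary vertices, including `b_1`. -/
def numBoundary (T : PlaneTree) : ℕ := T.leaves.length + 1

/-- `m(v)` for an internal vertex `v` of helicity `h` and degree `d`: it is `d - 1` if `v` is white
(`h = 1`) or black (`h = d - 1`), and `2 d - 4` if `v` is generic. -/
def vertexDim (h d : ℕ) : ℕ := if h = 1 ∨ h + 1 = d then d - 1 else 2 * d - 4

/-- `∑ (m(v) - 1)` over the internal vertices `v`. -/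
def sumVertexDim : PlaneTree → ℕ
  | leaf => 0
  | node h m c => (vertexDim h (m + 1) - 1) + ∑ i, (c i).sumVertexDim

/-- The mom-dimension (momentum amplituhedron dimension) of a Grassmannian tree. -/
def momDim (T : PlaneTree) : ℕ :=
  if T.numBoundary ≤ 2 then T.numBoundary - 1 else 1 + T.sumVertexDim

/-! ### Trips -/

/-- Directed edges: the edge with a given address, traversed away from `b_1` (`down`) or
towards `b_1` (`up`). -/
inductive Dart : Type
  | down (a : Address) : Dart
  | up (a : Address) : Dart

/-- The `j`-th edge in the clockwise order at the internal vertex with address `a`, directed towards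
the vertex; the edge towards `b_1` is number `0`. -/
def inDart (a : Address) : ℕ → Dart
  | 0 => Dart.down a
  | j + 1 => Dart.up (a ++ [j])

/-- The `j`-th edge in the clockwise order at the internal vertex with address `a`, directed away
from the vertex. -/
def outDart (a : Address) : ℕ → Dart
  | 0 => Dart.up a
  | j + 1 => Dart.down (a ++ [j])

/-- The rules of the road: a trip that enters an internal vertex of helicity `h` and degree
`d = m + 1` through the `j`-th edge in the clockwise order leaves it through edge number
`j + h` modulo `d`. -/
inductive TripStep (T : PlaneTree) : Dart → Dart → Prop
  | turn (a : Address) (h m : ℕ) (c : Fin m → PlaneTree) (j : ℕ) :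
      T.subtreeAt a = some (node h m c) → j < m + 1 →
      TripStep T (inDart a j) (outDart a ((j + h) % (m + 1)))

/-- The edge at a boundary vertex, directed away from the boundary vertex; `0` stands for `b_1`,
and `i + 1 < n` for `b_{i+2}`. -/
def startDart (T : PlaneTree) : ℕ → Dart
  | 0 => Dart.down []
  | i + 1 => Dart.up (T.leaves.getD i [])

/-- The edge at a boundary vertex, directed towards the boundary vertex. -/
def endDart (T : PlaneTree) : ℕ → Dart
  | 0 => Dart.up []
  | i + 1 => Dart.down (T.leaves.getD i [])

/-- `w` is the decorated trip permutation of the tree `T`: `T` has `n` boundary vertices, for every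
`i` the trip that starts at the `i`-th boundary vertex ends at the `w(i)`-th one, and a fixed point
of `w` is white when it is incident to a boundary leaf of helicity `1`, and black otherwise. (A tree
with a boundary leaf has no other internal vertex and just one boundary vertex.) -/
def IsTripPerm (T : PlaneTree) {n : ℕ} (w : DecoratedPerm n) : Prop :=
  T.numBoundary = n ∧
  (∀ i : Fin n, Relation.ReflTransGen T.TripStep (T.startDart i) (T.endDart (w.perm i))) ∧
  (∀ i : Fin n, i ∈ w.white ↔ w.perm i = i ∧ ∃ c, T = node 1 0 c)

end PlaneTree

/-- The decorated permutation `w` has mom-dimension `r`: it is the decorated trip permutation of a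
Grassmannian tree of mom-dimension `r`. -/
def HasMomDim {n : ℕ} (w : DecoratedPerm n) (r : ℕ) : Prop :=
  ∃ T : PlaneTree, T.IsGrassmannian ∧ T.IsTripPerm w ∧ T.momDim = r

/-! ### The generating function -/

/-- Power series in `x` whose coefficients are polynomials in `q` over `ℤ[y]`. -/
abbrev GF : Type := PowerSeries (Polynomial (Polynomial ℤ))

noncomputable section

/-- The variable `x`. -/
def x : GF := PowerSeries.X

/-- The variable `y`. -/
def y : GF := PowerSeries.C (Polynomial.C Polynomial.X)

/-- The variable `q`. -/
def q : GF := PowerSeries.C Polynomial.X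

/-- The numerator of `C(x,y,q)`. -/
def numC : GF :=
  x * (1 - x * (1 + y) * q ^ 2 - x ^ 2 * y * q ^ 2 * (1 + q - q ^ 2)
    - x ^ 4 * y ^ 2 * q ^ 5 * (1 + q))

/-- The denominator of `C(x,y,q)`. -/
def denC : GF :=
  (1 + x * q) * (1 + x * y * q) * (1 - x * q ^ 2) * (1 - x * y * q ^ 2)

/-- The power series `C(x,y,q)`; the denominator has constant coefficient `1`. -/
def seriesC : GF := numC * PowerSeries.invOfUnit denC 1

theorem denC_mul_invOfUnit : denC * PowerSeries.invOfUnit denC 1 = 1 :=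
  PowerSeries.mul_invOfUnit denC 1 (by simp [denC, x])

theorem constantCoeff_seriesC : PowerSeries.constantCoeff seriesC = 0 := by
  simp [seriesC, numC, x]

theorem coeff_one_seriesC : PowerSeries.coeff 1 seriesC = 1 := by
  have h : seriesC = PowerSeries.X * ((1 - x * (1 + y) * q ^ 2
      - x ^ 2 * y * q ^ 2 * (1 + q - q ^ 2) - x ^ 4 * y ^ 2 * q ^ 5 * (1 + q))
      * PowerSeries.invOfUnit denC 1) := by
    rw [seriesC, numC, mul_assoc]
    rfl
  rw [h, show (1:ℕ) = 0 + 1 from rfl, PowerSeries.coeff_succ_X_mul]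
  simp [x, PowerSeries.constantCoeff_invOfUnit]

theorem isUnit_coeff_one_seriesC : IsUnit (PowerSeries.coeff 1 seriesC) := by
  rw [coeff_one_seriesC]
  exact isUnit_one

/-- The compositional inverse of `C(x,y,q)` with respect to `x`. -/
def inverseC : GF := PowerSeries.substInvOfIsUnit seriesC isUnit_coeff_one_seriesC

/-- `G_tree(x,y,q) = x (1 + y + y q C^{⟨-1⟩}(x,y,q))`. -/
def treeGF : GF := x * (1 + y + y * q * inverseC)

/-- The coefficient `[x^n y^k q^r] G`. -/
def coeffXYQ (n k r : ℕ) (G : GF) : ℤ := ((PowerSeries.coeff n G).coeff r).coeff k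

end

end GrassmannianTree

/-! The proof replaces permutations by a canonical tree for each of them, and then counts these
trees.

Permutations and trees. Cut open at `b_1`, a tree without boundary leaf has a recursively computed
trip map (`star`, `trip`), and the trips defined as paths of darts end where this map says
(`IsProper.isTripPerm_iff`). Joining two trees at their root edges is, on trips, the amalgamation,
once the root of the first tree is moved to its last leaf (`amalgamate_eq_joinTrip`,
`exists_joinTrip_leaf`); moving the root is cyclic rotation. Hence every built permutation is the
trip map of a tree (`IsBuilt.isTripMap`). Conversely, cutting the internal edges of a tree leaves
single vertices, whose trip maps are the `π_{k,n}` (`IsProper.isLeafOrBuilt`).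

Normal forms. Different trees may have the same trips, because an edge between two white or two
black vertices can be contracted. This keeps the dimension: a white or black vertex of degree `d`
contributes `d - 2`, as much as the `d - 2` trivalent vertices into which it splits. Splitting all
these vertices into trivalent ones and reassociating (`equivalent_bin_assoc`) gives an equivalent
tree in which no white or black vertex has a last child of its own colour
(`IsProper.exists_isNormal`). Such a tree is determined by its trips (`IsNormal.eq_of_trip_eq`):
exactly one trip leaves the leaves below a child of the root vertex, whereas at least two leave a
longer segment with the same start, unless it consists of all the leaves
(`IsNormal.exists_two_exits`). So the blocks of leaves below the children can be read off the
permutation, and one recurses. The mom-dimension is therefore well defined.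

Counting. Antiexcedances are descents of the trip map, and their number is `1 + ∑ (h(v) - 1)`, since
the rotation by `h` at a vertex wraps around on exactly `h` edges (`IsProper.numDescents_trip`). Let
`F` be the generating function of normal trees by leaves, `∑ (h(v) - 1)` and `∑ (m(v) - 1)`. A white
root gives `W = q F (F - W)`, a black one `B = y q F (F - B)`, and the generic ones sum to `y q³ F³
/ ((1 - q² F)(1 - y q² F))`. Then `F = x + W + B + generic` says `C(F) = x`, so `F` is the
compositional inverse. The factor `x y q` accounts for the root and the two summands `1`; the term
`x (1 + y)` counts the two permutations on one letter. -/

namespace GrassmannianTree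

open Finset

/-! ### Self-maps of an initial segment without fixed points -/

/-- `w` restricts to a fixed point free permutation of `{0, …, l}`. -/
structure IsDerangement (l : ℕ) (w : ℕ → ℕ) : Prop where
  le : ∀ x ≤ l, w x ≤ l
  inj : ∀ x ≤ l, ∀ y ≤ l, w x = w y → x = y
  ne : ∀ x ≤ l, w x ≠ x

theorem IsDerangement.surj {l : ℕ} {w : ℕ → ℕ} (hw : IsDerangement l w) {y : ℕ} (hy : y ≤ l) :
    ∃ x ≤ l, w x = y := by
  have hmap : ∀ a ∈ range (l + 1), w a ∈ range (l + 1) := fun a ha => by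
    have := hw.le a (by simpa [Nat.lt_succ_iff] using ha)
    simpa [Nat.lt_succ_iff] using this
  have hinj : Set.InjOn w (range (l + 1)) := fun a ha b hb hab => by
    simp only [coe_range, Set.mem_Iio, Nat.lt_succ_iff] at ha hb
    exact hw.inj a ha b hb hab
  obtain ⟨x, hx, hxy⟩ := Finset.surjOn_of_injOn_of_card_le w hmap hinj le_rfl
    (by simpa [Nat.lt_succ_iff] using hy : y ∈ (range (l + 1) : Set ℕ))
  exact ⟨x, by simpa [Nat.lt_succ_iff] using hx, hxy⟩

/-- With `0` standing for the root, this is the leaf whose trip leaves the tree through the root. -/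
theorem IsDerangement.exists_exit {l : ℕ} {w : ℕ → ℕ} (hw : IsDerangement l w) :
    ∃ z < l, w (z + 1) = 0 := by
  obtain ⟨x, hx, h0⟩ := hw.surj (Nat.zero_le l)
  rcases x with _ | z
  · exact absurd h0 (hw.ne 0 hx)
  · exact ⟨z, hx, h0⟩

/-- The number of `x < n` with `w x < x`. -/
def numDescents (n : ℕ) (w : ℕ → ℕ) : ℕ := ∑ x ∈ range n, if w x < x then 1 else 0

/-! ### Consecutive blocks -/

/-- The first position of the `e`-th of consecutive blocks of lengths `L 0, L 1, …`. -/
def off (L : ℕ → ℕ) (e : ℕ) : ℕ := ∑ j ∈ range e, L j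

@[simp] theorem off_zero (L : ℕ → ℕ) : off L 0 = 0 := by simp [off]

theorem off_succ (L : ℕ → ℕ) (e : ℕ) : off L (e + 1) = off L e + L e := by
  simp [off, sum_range_succ]

theorem off_mono (L : ℕ → ℕ) {a b : ℕ} (h : a ≤ b) : off L a ≤ off L b :=
  sum_le_sum_of_subset (range_subset_range.2 h)

theorem off_add_le (L : ℕ → ℕ) {a b : ℕ} (h : a < b) : off L a + L a ≤ off L b := by
  rw [← off_succ]; exact off_mono L h

theorem off_congr {L L' : ℕ → ℕ} {e : ℕ} (h : ∀ j < e, L j = L' j) : off L e = off L' e :=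
  sum_congr rfl fun j hj => h j (mem_range.1 hj)

theorem off_succ' (L : ℕ → ℕ) (e : ℕ) : off L (e + 1) = L 0 + off (fun i => L (i + 1)) e := by
  simp only [off, sum_range_succ', add_comm]

theorem exists_block {L : ℕ → ℕ} {d x : ℕ} (h : x < off L d) :
    ∃ e < d, ∃ z < L e, x = off L e + z := by
  induction d with
  | zero => simp at h
  | succ d ih =>
    by_cases hx : x < off L d
    · obtain ⟨e, he, z, hz, rfl⟩ := ih hx
      exact ⟨e, by omega, z, hz, rfl⟩
    · rw [off_succ] at h
      exact ⟨d, by omega, x - off L d, by omega, by omega⟩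

theorem block_unique {L : ℕ → ℕ} {e e' z z' : ℕ} (hz : z < L e) (hz' : z' < L e')
    (h : off L e + z = off L e' + z') : e = e' ∧ z = z' := by
  rcases lt_trichotomy e e' with h1 | rfl | h1
  · have := off_add_le L h1; omega
  · omega
  · have := off_add_le L h1; omega

theorem sum_range_off {M : Type*} [AddCommMonoid M] (L : ℕ → ℕ) (d : ℕ) (F : ℕ → M) :
    ∑ x ∈ range (off L d), F x = ∑ e ∈ range d, ∑ z ∈ range (L e), F (off L e + z) := by
  induction d with
  | zero => simp
  | succ d ih => rw [off_succ, sum_range_add, sum_range_succ, ih]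

/-! ### Trip maps around a vertex -/

/-- The trip map around a vertex of degree `d` and helicity `h`. Below the `e`-th edge there are
`L e` boundary vertices and the trips are given by `W e`, where `0` stands for the vertex. The
boundary vertices are numbered consecutively from `0`. -/
def star (h d : ℕ) (L : ℕ → ℕ) (W : ℕ → ℕ → ℕ) (x : ℕ) : ℕ :=
  let e := Nat.findGreatest (fun e => off L e ≤ x) (d - 1)
  let v := W e (x - off L e + 1)
  if v = 0 then off L ((e + h) % d) + (W ((e + h) % d) 0 - 1) else off L e + (v - 1)

theorem star_apply (h : ℕ) {d : ℕ} {L : ℕ → ℕ} (W : ℕ → ℕ → ℕ) {e z : ℕ} (he : e < d)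
    (hz : z < L e) : star h d L W (off L e + z) =
      if W e (z + 1) = 0 then off L ((e + h) % d) + (W ((e + h) % d) 0 - 1)
      else off L e + (W e (z + 1) - 1) := by
  have hb' : Nat.findGreatest (fun e' => off L e' ≤ off L e + z) (d - 1) = e := by
    rw [Nat.findGreatest_eq_iff]
    refine ⟨by omega, fun _ => by omega, fun n hn _ => ?_⟩
    have := off_add_le L hn
    omega
  simp only [star, hb', Nat.add_sub_cancel_left]

theorem add_mod_ne_self {e h d : ℕ} (he : e < d) (h1 : 1 ≤ h) (hd : h < d) : (e + h) % d ≠ e := by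
  rcases lt_or_ge (e + h) d with hlt | hge
  · rw [Nat.mod_eq_of_lt hlt]; omega
  · rw [Nat.mod_eq_sub_mod hge, Nat.mod_eq_of_lt (by omega)]; omega

theorem add_mod_inj {e e' h d : ℕ} (he : e < d) (he' : e' < d)
    (h : (e + h) % d = (e' + h) % d) : e = e' := by
  have := Nat.ModEq.add_right_cancel' _ h
  rwa [Nat.ModEq, Nat.mod_eq_of_lt he, Nat.mod_eq_of_lt he'] at this

theorem add_mod_lt_self_iff {e h d : ℕ} (he : e < d) (hd : h < d) :
    (e + h) % d < e ↔ d ≤ e + h := by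
  rcases lt_or_ge (e + h) d with hlt | hge
  · rw [Nat.mod_eq_of_lt hlt]; omega
  · rw [Nat.mod_eq_sub_mod hge, Nat.mod_eq_of_lt (by omega)]; omega

theorem add_mod_eq {e h d : ℕ} (he : e < d) (hd : h < d) :
    (e + h) % d = if e + h < d then e + h else e + h - d := by
  split_ifs with hlt
  · exact Nat.mod_eq_of_lt hlt
  · rw [Nat.mod_eq_sub_mod (by omega), Nat.mod_eq_of_lt (by omega)]

section star

variable {h d : ℕ} {L : ℕ → ℕ} {W : ℕ → ℕ → ℕ}

theorem isDerangement_star (h1 : 1 ≤ h) (hd : h < d) (hL : ∀ e < d, 1 ≤ L e)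
    (hW : ∀ e < d, IsDerangement (L e) (W e)) : IsDerangement (off L d - 1) (star h d L W) := by
  have hd0 : 0 < d := by omega
  have hpos : 1 ≤ off L d := by
    have := off_add_le L hd0
    have := hL 0 hd0
    omega
  -- Every value is a value of some branch map `W e'`, taken at `0` when the trip comes through the
  -- vertex and at `z + 1` otherwise. Injectivity thus reduces to that of the branches and of the
  -- rotation by `h`.
  have key : ∀ e < d, ∀ z < L e, ∃ e' < d, ∃ z' < L e',
      star h d L W (off L e + z) = off L e' + z' ∧
      (W e (z + 1) = 0 ∧ e' = (e + h) % d ∧ W e' 0 = z' + 1 ∨ e' = e ∧ W e (z + 1) = z' + 1) := by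
    intro e he z hz
    rw [star_apply h W he hz]
    by_cases hv : W e (z + 1) = 0
    · have he' : (e + h) % d < d := Nat.mod_lt _ hd0
      have a1 := (hW _ he').le 0 (Nat.zero_le _)
      have a2 := (hW _ he').ne 0 (Nat.zero_le _)
      exact ⟨(e + h) % d, he', W ((e + h) % d) 0 - 1, by omega, by simp [hv],
        Or.inl ⟨hv, rfl, by omega⟩⟩
    · have a1 := (hW e he).le (z + 1) hz
      exact ⟨e, he, W e (z + 1) - 1, by omega, by simp [hv], Or.inr ⟨rfl, by omega⟩⟩
  refine ⟨fun x hx => ?_, fun x hx y hy hxy => ?_, fun x hx => ?_⟩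
  · obtain ⟨e, he, z, hz, rfl⟩ := exists_block (L := L) (d := d) (x := x) (by omega)
    obtain ⟨e', he', z', hz', h', -⟩ := key e he z hz
    have := off_add_le L he'
    omega
  · obtain ⟨e, he, z, hz, rfl⟩ := exists_block (L := L) (d := d) (x := x) (by omega)
    obtain ⟨f, hf, u, hu, rfl⟩ := exists_block (L := L) (d := d) (x := y) (by omega)
    obtain ⟨e', he', z', hz', hx', hx⟩ := key e he z hz
    obtain ⟨f', hf', u', hu', hy', hy⟩ := key f hf u hu
    rw [hx', hy'] at hxy
    obtain ⟨rfl, rfl⟩ := block_unique hz' hu' hxy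
    rcases hx with ⟨hx1, hx2, hx3⟩ | ⟨rfl, hx2⟩ <;> rcases hy with ⟨hy1, hy2, hy3⟩ | ⟨rfl, hy2⟩
    · obtain rfl := add_mod_inj he hf (hx2.symm.trans hy2)
      have := (hW e he).inj (z + 1) hz (u + 1) (by omega) (hx1.trans hy1.symm)
      omega
    · have := (hW _ he').inj 0 (by omega) (u + 1) (by omega) (hx3.trans hy2.symm)
      omega
    · have := (hW _ he').inj 0 (by omega) (z + 1) (by omega) (hy3.trans hx2.symm)
      omega
    · have := (hW _ he').inj (z + 1) (by omega) (u + 1) (by omega) (hx2.trans hy2.symm)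
      omega
  · obtain ⟨e, he, z, hz, rfl⟩ := exists_block (L := L) (d := d) (x := x) (by omega)
    obtain ⟨e', he', z', hz', hx', hx⟩ := key e he z hz
    rw [hx']
    intro hxy
    obtain ⟨rfl, rfl⟩ := block_unique hz' hz hxy
    rcases hx with ⟨hx1, hx2, hx3⟩ | ⟨hx1, hx2⟩
    · exact add_mod_ne_self he h1 hd hx2.symm
    · exact (hW _ he').ne (z' + 1) hz hx2

/-- Only the trip that exits the branch changes status. Inside the branch it ends at `0` and is a
descent; around the vertex it ends in another block, and is a descent exactly when that block comes
earlier. -/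
theorem numDescents_block {e : ℕ} (h1 : 1 ≤ h) (hd : h < d) (he : e < d)
    (hW : ∀ e < d, IsDerangement (L e) (W e)) :
    (∑ z ∈ range (L e), if star h d L W (off L e + z) < off L e + z then 1 else 0) + 1 =
      numDescents (L e + 1) (W e) + if (e + h) % d < e then 1 else 0 := by
  obtain ⟨z₀, hz₀, hw₀⟩ := (hW e he).exists_exit
  have hd0 : 0 < d := by omega
  rw [numDescents, sum_range_succ', ← add_sum_erase (range (L e)) _ (mem_range.2 hz₀),
    ← add_sum_erase (range (L e)) (fun z => if W e (z + 1) < z + 1 then 1 else 0)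
      (mem_range.2 hz₀)]
  have hrest : ∑ z ∈ (range (L e)).erase z₀,
      (if star h d L W (off L e + z) < off L e + z then 1 else 0) =
      ∑ z ∈ (range (L e)).erase z₀, (if W e (z + 1) < z + 1 then 1 else 0) := by
    refine sum_congr rfl fun z hz => ?_
    rw [mem_erase, mem_range] at hz
    have hv : W e (z + 1) ≠ 0 := fun hv => by
      have := (hW e he).inj (z + 1) hz.2 (z₀ + 1) hz₀ (hv.trans hw₀.symm)
      omega
    rw [star_apply h W he hz.2, if_neg hv]
    refine if_congr ?_ rfl rfl
    omega
  have hz : star h d L W (off L e + z₀) < off L e + z₀ ↔ (e + h) % d < e := by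
    rw [star_apply h W he hz₀, if_pos hw₀]
    have he' : (e + h) % d < d := Nat.mod_lt _ hd0
    have a1 := (hW _ he').le 0 (Nat.zero_le _)
    have a2 := (hW _ he').ne 0 (Nat.zero_le _)
    have a3 := add_mod_ne_self he h1 hd
    rcases lt_or_gt_of_ne a3 with a4 | a4
    · have := off_add_le L a4
      omega
    · have := off_add_le L a4
      omega
  rw [hrest, if_congr hz rfl rfl]
  simp only [hw₀, Nat.not_lt_zero, if_false, Nat.zero_lt_succ, if_true]
  omega

theorem numDescents_star (h1 : 1 ≤ h) (hd : h < d)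
    (hW : ∀ e < d, IsDerangement (L e) (W e)) :
    numDescents (off L d) (star h d L W) + d =
      h + ∑ e ∈ range d, numDescents (L e + 1) (W e) := by
  -- The rotation wraps around precisely on the last `h` edges `d - h, …, d - 1`.
  have hs : ∑ e ∈ range d, (if (e + h) % d < e then 1 else 0) = h := by
    rw [← card_filter]
    have : (range d).filter (fun e => (e + h) % d < e) = Ico (d - h) d := by
      ext e
      simp only [mem_filter, mem_range, mem_Ico]
      constructor
      · rintro ⟨he, hlt⟩
        rw [add_mod_lt_self_iff he hd] at hlt
        omega
      · rintro ⟨h2, he⟩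
        rw [add_mod_lt_self_iff he hd]
        omega
    rw [this, Nat.card_Ico]
    omega
  have := sum_congr rfl fun e (he : e ∈ range d) =>
    numDescents_block h1 hd (mem_range.1 he) hW
  rw [sum_add_distrib, sum_add_distrib, hs, sum_const, card_range, smul_eq_mul, mul_one] at this
  rw [numDescents, sum_range_off]
  omega

theorem star_congr {L' : ℕ → ℕ} {W' : ℕ → ℕ → ℕ} (hd : 0 < d) (hL : ∀ e < d, L e = L' e)
    (hW : ∀ e < d, ∀ z ≤ L e, W e z = W' e z) {x : ℕ} (hx : x < off L d) :
    star h d L W x = star h d L' W' x := by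
  obtain ⟨e, he, z, hz, rfl⟩ := exists_block hx
  have ho : ∀ e < d, off L e = off L' e := fun e he => off_congr fun j hj => hL j (by omega)
  have he' : (e + h) % d < d := Nat.mod_lt _ hd
  rw [star_apply h W he hz, ho e he, star_apply h W' he (by rwa [← hL e he]), hW e he _ hz,
    hW _ he' 0 (Nat.zero_le _), ho _ he']

end star

end GrassmannianTree
-- Trip maps of rooted trees and their agreement with paths of darts
namespace GrassmannianTree

open Finset

/-- The sequence that starts with `a` and continues with the entries of `c`. -/
def kid {α : Type*} (a : α) {m : ℕ} (c : Fin m → α) : ℕ → α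
  | 0 => a
  | i + 1 => if hi : i < m then c ⟨i, hi⟩ else a

section kid

variable {α β : Type*} (a : α) {m : ℕ} (c : Fin m → α)

@[simp] theorem kid_zero : kid a c 0 = a := rfl

theorem kid_succ {i : ℕ} (hi : i < m) : kid a c (i + 1) = c ⟨i, hi⟩ := by simp [kid, hi]

theorem map_kid (f : α → β) (e : ℕ) : f (kid a c e) = kid (f a) (fun i => f (c i)) e := by
  rcases e with _ | i
  · rfl
  · simp only [kid]; split_ifs <;> rfl

theorem kid_forall {p : α → Prop} (ha : p a) (hc : ∀ i, p (c i)) (e : ℕ) : p (kid a c e) := by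
  rcases e with _ | i
  · exact ha
  · simp only [kid]; split_ifs <;> simp [ha, hc]

end kid

namespace PlaneTree

/-- The number of leaves. -/
def numLeaves : PlaneTree → ℕ
  | leaf => 1
  | node _ _ c => ∑ i, (c i).numLeaves

/-- The trip map; the root is `0` and the leaves are numbered from `1`. -/
def trip : PlaneTree → ℕ → ℕ
  | leaf => fun x => if x = 0 then 1 else 0
  | node h m c => star h (m + 1) (kid 1 fun i => (c i).numLeaves)
      (kid (fun x => if x = 0 then 1 else 0) fun i => (c i).trip)

/-- The trip map around a vertex of degree `d` and helicity `h` with the trees `t 0, …, t (d-1)`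
attached to it. -/
abbrev starTrip (h d : ℕ) (t : ℕ → PlaneTree) : ℕ → ℕ :=
  star h d (fun e => (t e).numLeaves) (fun e => (t e).trip)

abbrev offset (t : ℕ → PlaneTree) : ℕ → ℕ := off fun e => (t e).numLeaves

theorem starTrip_apply (h : ℕ) {d : ℕ} (t : ℕ → PlaneTree) {e z : ℕ} (he : e < d)
    (hz : z < (t e).numLeaves) : starTrip h d t (offset t e + z) =
      if (t e).trip (z + 1) = 0 then offset t ((e + h) % d) + ((t ((e + h) % d)).trip 0 - 1)
      else offset t e + ((t e).trip (z + 1) - 1) :=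
  star_apply (L := fun e => (t e).numLeaves) h (fun e => (t e).trip) he hz

theorem exists_offset {t : ℕ → PlaneTree} {d x : ℕ} (h : x < offset t d) :
    ∃ e < d, ∃ z < (t e).numLeaves, x = offset t e + z :=
  exists_block h

@[simp] theorem numLeaves_leaf : leaf.numLeaves = 1 := rfl

theorem trip_leaf (x : ℕ) : leaf.trip x = if x = 0 then 1 else 0 := rfl

/-- The root edge counts as branch number `0`, consisting of a single leaf, so that all edges at the
vertex are on the same footing and position `0` is the root. -/
theorem trip_node (h m : ℕ) (c : Fin m → PlaneTree) :
    (node h m c).trip = starTrip h (m + 1) (kid leaf c) := by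
  have h1 : (fun e => (kid leaf c e).numLeaves) = kid 1 fun i => (c i).numLeaves :=
    funext fun e => map_kid leaf c numLeaves e
  have h2 : (fun e => (kid leaf c e).trip) =
      kid (fun x => if x = 0 then 1 else 0) fun i => (c i).trip :=
    funext fun e => map_kid leaf c trip e
  rw [starTrip, h1, h2]
  rfl

theorem offset_kid (a : PlaneTree) {m : ℕ} (c : Fin m → PlaneTree) :
    offset (kid a c) (m + 1) = a.numLeaves + ∑ i, (c i).numLeaves := by
  rw [offset, off_succ', off, Finset.sum_range]
  simp only [kid_zero, Nat.add_left_cancel_iff]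
  exact Finset.sum_congr rfl fun i _ => by rw [kid_succ a c i.isLt]

theorem numLeaves_node (h m : ℕ) (c : Fin m → PlaneTree) :
    (node h m c).numLeaves + 1 = offset (kid leaf c) (m + 1) := by
  rw [offset_kid, numLeaves_leaf, add_comm]
  rfl

theorem IsProper.kids {h m : ℕ} {c : Fin m → PlaneTree} (hT : (node h m c).IsProper)
    {a : PlaneTree} (ha : a.IsProper) (e : ℕ) : (kid a c e).IsProper :=
  kid_forall a c ha hT.2.2.2 e

theorem isDerangement_leaf : IsDerangement 1 leaf.trip := by
  refine ⟨fun x hx => ?_, fun x hx y hy => ?_, fun x hx => ?_⟩ <;> simp only [trip_leaf]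
  · split_ifs <;> omega
  · intro h
    split_ifs at h <;> omega
  · split_ifs <;> omega

theorem IsProper.one_le_numLeaves {T : PlaneTree} (hT : T.IsProper) : 1 ≤ T.numLeaves := by
  induction T with
  | leaf => exact le_rfl
  | node h m c ih =>
    have h0 : 0 < m := by have := hT.1; omega
    exact (ih ⟨0, h0⟩ (hT.2.2.2 _)).trans
      (single_le_sum (f := fun i => (c i).numLeaves) (fun i _ => Nat.zero_le _) (mem_univ _))

theorem IsProper.isDerangement {T : PlaneTree} (hT : T.IsProper) :
    IsDerangement T.numLeaves T.trip := by
  induction T with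
  | leaf => exact isDerangement_leaf
  | node h m c ih =>
    rw [trip_node, show (node h m c).numLeaves = offset (kid leaf c) (m + 1) - 1
      by rw [← numLeaves_node h m c]; rfl]
    exact isDerangement_star hT.2.1 (Nat.lt_succ_of_le hT.2.2.1)
      (fun e _ => (hT.kids (a := leaf) trivial e).one_le_numLeaves)
      (fun e _ => kid_forall (p := fun T => IsDerangement T.numLeaves T.trip) leaf c
        isDerangement_leaf (fun i => ih i (hT.2.2.2 i)) e)

/-- `∑ (h(v) - 1)` over the internal vertices `v`. -/
def sumHelicity : PlaneTree → ℕ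
  | leaf => 0
  | node h _ c => (h - 1) + ∑ i, (c i).sumHelicity

theorem IsProper.numDescents_trip {T : PlaneTree} (hT : T.IsProper) :
    numDescents (T.numLeaves + 1) T.trip = T.sumHelicity + 1 := by
  induction T with
  | leaf => simp [numDescents, trip_leaf, sumHelicity, sum_range_succ]
  | node h m c ih =>
    have := numDescents_star (h := h) (d := m + 1) hT.2.1 (Nat.lt_succ_of_le hT.2.2.1)
      (L := fun e => (kid leaf c e).numLeaves)
      (W := fun e => (kid leaf c e).trip)
      (fun e _ => (hT.kids (a := leaf) trivial e).isDerangement)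
    rw [sum_range_succ', Finset.sum_range] at this
    have h2 : ∀ i : Fin m, numDescents
        ((kid leaf c (i + 1)).numLeaves + 1)
        (kid leaf c (i + 1)).trip = (c i).sumHelicity + 1 := fun i => by
      rw [kid_succ leaf c i.isLt]; exact ih i (hT.2.2.2 i)
    have h3 : numDescents (leaf.numLeaves + 1) leaf.trip = 1 := by
      simp [numDescents, trip_leaf, sum_range_succ]
    rw [sum_congr rfl fun i _ => h2 i, sum_add_distrib, kid_zero, h3] at this
    rw [numLeaves_node, trip_node, sumHelicity]
    have h1 := hT.2.1
    simp only [sum_const, card_univ, Fintype.card_fin, smul_eq_mul, mul_one] at this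
    simp only [starTrip, offset]
    omega

/-! ### Trips as paths -/

theorem length_leaves (T : PlaneTree) : T.leaves.length = T.numLeaves := by
  induction T with
  | leaf => rfl
  | node h m c ih => simp [leaves, numLeaves, List.length_flatMap, ih, Fin.sum_univ_def]

end PlaneTree

theorem getElem?_flatMap_finRange {β : Type*} {m : ℕ} (F : Fin m → List β) (L : ℕ → ℕ)
    (hL : ∀ i : Fin m, L i = (F i).length) (i : Fin m) {z : ℕ} (hz : z < L i) :
    ((List.finRange m).flatMap F)[off L i + z]? = (F i)[z]? := by
  induction m generalizing L with
  | zero => exact i.elim0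
  | succ m ih =>
    rw [List.finRange_succ, List.flatMap_cons, List.flatMap_map]
    refine Fin.cases ?_ (fun i => ?_) i (motive := fun i => z < L i →
      (F 0 ++ List.flatMap (fun a => F a.succ) (List.finRange m))[off L i + z]? = (F i)[z]?) hz
    · intro hz
      have := hL 0
      simp only [Fin.val_zero, off_zero, Nat.zero_add] at *
      rw [List.getElem?_append_left (by omega)]
    · intro hz
      have h0 := hL 0
      simp only [Fin.val_zero] at h0
      rw [Fin.val_succ, off_succ', List.getElem?_append_right (by omega), h0,
        show (F 0).length + off (fun i => L (i + 1)) i + z - (F 0).length =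
          off (fun i => L (i + 1)) i + z by omega]
      exact ih (fun a => F a.succ) (fun i => L (i + 1)) (fun j => by simpa using hL j.succ) i hz

namespace PlaneTree

/-- A directed edge below the `i`-th child of the root vertex. -/
def Dart.lift (i : ℕ) : Dart → Dart
  | Dart.down a => Dart.down (i :: a)
  | Dart.up a => Dart.up (i :: a)

theorem lift_inDart (i : ℕ) (a : Address) (j : ℕ) : (inDart a j).lift i = inDart (i :: a) j := by
  cases j <;> rfl

theorem lift_outDart (i : ℕ) (a : Address) (j : ℕ) :
    (outDart a j).lift i = outDart (i :: a) j := by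
  cases j <;> rfl

theorem TripStep.lift {h m : ℕ} {c : Fin m → PlaneTree} (i : Fin m) {d d' : Dart}
    (hs : (c i).TripStep d d') : (node h m c).TripStep (d.lift i) (d'.lift i) := by
  obtain ⟨a, h', m', c', j, hsub, hj⟩ := hs
  rw [lift_inDart, lift_outDart]
  exact TripStep.turn _ _ _ c' _ (by simpa [subtreeAt] using hsub) hj

theorem getD_leaves_node (h m : ℕ) (c : Fin m → PlaneTree) (i : Fin m) {z : ℕ}
    (hz : z < (c i).numLeaves) :
    (node h m c).leaves.getD (off (fun e => (kid leaf c (e + 1)).numLeaves) i + z) [] =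
      i.val :: (c i).leaves.getD z [] := by
  have hk : ∀ i : Fin m, kid leaf c (i + 1) = c i := fun i => kid_succ leaf c i.isLt
  rw [leaves, List.getD_eq_getElem?_getD, getElem?_flatMap_finRange
    (fun i => (c i).leaves.map (fun a => i.val :: a)) _ (fun i => by
      simp [hk, length_leaves]) i (by rw [hk]; exact hz)]
  rw [← length_leaves] at hz
  simp [hz]

theorem startDart_node (h m : ℕ) (c : Fin m → PlaneTree) (i : Fin m) {z : ℕ}
    (hz : z < (c i).numLeaves) :
    (node h m c).startDart (offset (kid leaf c) (i + 1) + z) =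
      ((c i).startDart (z + 1)).lift i := by
  rw [offset, off_succ', kid_zero, numLeaves_leaf, Nat.add_assoc, Nat.add_comm 1]
  simp only [startDart, getD_leaves_node h m c i hz]
  rfl

theorem endDart_node (h m : ℕ) (c : Fin m → PlaneTree) (i : Fin m) {z : ℕ}
    (hz : z < (c i).numLeaves) :
    (node h m c).endDart (offset (kid leaf c) (i + 1) + z) =
      ((c i).endDart (z + 1)).lift i := by
  rw [offset, off_succ', kid_zero, numLeaves_leaf, Nat.add_assoc, Nat.add_comm 1]
  simp only [endDart, getD_leaves_node h m c i hz]
  rfl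

/-- The recursion for `trip` follows the path: inside a child up to the root vertex, one turn there,
and down into another child; or it stays inside one child. Paths in a child are lifted by prefixing
addresses. -/
theorem IsProper.reflTransGen_trip {T : PlaneTree} (hT : T.IsProper) {x : ℕ}
    (hx : x ≤ T.numLeaves) :
    Relation.ReflTransGen T.TripStep (T.startDart x) (T.endDart (T.trip x)) := by
  induction T generalizing x with
  | leaf =>
    have : x = 0 ∨ x = 1 := by rw [numLeaves_leaf] at hx; omega
    rcases this with rfl | rfl <;> exact Relation.ReflTransGen.refl
  | node h m c ih =>
    have hlift : ∀ (i : Fin m) {d d' : Dart}, Relation.ReflTransGen (c i).TripStep d d' →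
        Relation.ReflTransGen (node h m c).TripStep (d.lift i) (d'.lift i) := fun i d d' hp =>
      Relation.ReflTransGen.lift (Dart.lift i) (fun _ _ hs => TripStep.lift i hs) _ _ hp
    have hkid : ∀ (i : Fin m), kid leaf c (i + 1) = c i :=
      fun i => kid_succ leaf c i.isLt
    have hout : ∀ e < m + 1, Relation.ReflTransGen (node h m c).TripStep (outDart [] e)
        ((node h m c).endDart (offset (kid leaf c) e +
          ((kid leaf c e).trip 0 - 1))) := by
      intro e he
      rcases e with _ | i
      · exact Relation.ReflTransGen.refl
      · have hp := hT.2.2.2 ⟨i, by omega⟩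
        have h1 := hp.isDerangement.le 0 (Nat.zero_le _)
        have h2 := hp.isDerangement.ne 0 (Nat.zero_le _)
        have h3 := hlift ⟨i, by omega⟩ (ih ⟨i, by omega⟩ hp (Nat.zero_le _))
        have h4 := endDart_node h m c ⟨i, by omega⟩
          (z := (c ⟨i, by omega⟩).trip 0 - 1) (by omega)
        rw [show (c ⟨i, by omega⟩).trip 0 - 1 + 1 = (c ⟨i, by omega⟩).trip 0 by omega] at h4
        rw [← h4] at h3
        rw [hkid ⟨i, by omega⟩]
        exact h3
    have hturn : ∀ e < m + 1, Relation.ReflTransGen (node h m c).TripStep (inDart [] e)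
        ((node h m c).endDart (offset (kid leaf c) ((e + h) % (m + 1)) +
          ((kid leaf c ((e + h) % (m + 1))).trip 0 - 1))) := fun e he =>
      Relation.ReflTransGen.head (TripStep.turn [] h m c e rfl he)
        (hout _ (Nat.mod_lt _ (Nat.succ_pos m)))
    obtain ⟨e, he, z, hz, rfl⟩ := exists_offset (t := kid leaf c) (d := m + 1) (x := x)
      (by have := numLeaves_node h m c; omega)
    rw [trip_node, starTrip_apply _ _ he hz]
    rcases e with _ | i
    · obtain rfl : z = 0 := by simpa using hz
      simpa [trip_leaf, startDart, inDart] using hturn 0 he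
    · have him : i < m := by omega
      have hp := hT.2.2.2 ⟨i, him⟩
      simp only [hkid ⟨i, him⟩] at hz ⊢
      have h3 := hlift ⟨i, him⟩ (ih ⟨i, him⟩ hp (x := z + 1) hz)
      have h5 := startDart_node h m c ⟨i, him⟩ hz
      rw [← h5] at h3
      refine h3.trans ?_
      split_ifs with hv
      · rw [hv]
        exact hturn (i + 1) he
      · have h1 := hp.isDerangement.le (z + 1) hz
        have h4 := endDart_node h m c ⟨i, him⟩
          (z := (c ⟨i, him⟩).trip (z + 1) - 1) (by omega)
        rw [show (c ⟨i, him⟩).trip (z + 1) - 1 + 1 = (c ⟨i, him⟩).trip (z + 1) by omega] at h4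
        rw [← h4]

/-! ### The end of a trip is unique -/

theorem TripStep.unique {T : PlaneTree} {d d₁ d₂ : Dart} (h₁ : T.TripStep d d₁)
    (h₂ : T.TripStep d d₂) : d₁ = d₂ := by
  obtain ⟨a, h, m, c, j, hsub, hj⟩ := h₁
  generalize hd : inDart a j = d at h₂
  obtain ⟨a', h', m', c', j', hsub', hj'⟩ := h₂
  have : a = a' ∧ j = j' := by
    rcases j with _ | j <;> rcases j' with _ | j' <;> simp [inDart] at hd
    · exact ⟨hd, rfl⟩
    · exact ⟨hd.1, by rw [hd.2]⟩
  obtain ⟨rfl, rfl⟩ := this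
  rw [hsub] at hsub'
  cases hsub'
  rfl

theorem subtreeAt_of_mem_leaves {T : PlaneTree} {a : Address} (ha : a ∈ T.leaves) :
    T.subtreeAt a = some leaf := by
  induction T generalizing a with
  | leaf =>
    obtain rfl : a = [] := by simpa [leaves] using ha
    rfl
  | node h m c ih =>
    simp only [leaves, List.mem_flatMap, List.mem_finRange, List.mem_map, true_and] at ha
    obtain ⟨i, b, hb, rfl⟩ := ha
    simpa [subtreeAt] using ih i hb

/-- The head of such a dart is a boundary vertex, so there is no vertex to turn at. -/
theorem not_tripStep_endDart {T : PlaneTree} {x : ℕ} (hx : x ≤ T.numLeaves) (d : Dart) :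
    ¬ T.TripStep (T.endDart x) d := by
  intro hs
  generalize hd : T.endDart x = d' at hs
  obtain ⟨a, h, m, c, j, hsub, hj⟩ := hs
  rcases x with _ | x <;> rcases j with _ | j <;> simp [inDart, endDart] at hd
  rw [← length_leaves] at hx
  have hx' : x < T.leaves.length := hx
  have := subtreeAt_of_mem_leaves (List.getElem_mem hx')
  rw [List.getElem?_eq_getElem hx', Option.getD_some] at hd
  rw [hd, hsub] at this
  simp at this

theorem nodup_leaves (T : PlaneTree) : T.leaves.Nodup := by
  induction T with
  | leaf => simp [leaves]
  | node h m c ih =>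
    rw [leaves, List.nodup_flatMap]
    refine ⟨fun i _ => (ih i).map fun a b hab => by simpa using hab, ?_⟩
    refine (List.nodup_finRange m).imp fun {i j} hij => ?_
    intro a ha hb
    simp only [List.mem_map] at ha hb
    obtain ⟨b, -, rfl⟩ := ha
    obtain ⟨b', -, hb'⟩ := hb
    simp only [List.cons.injEq] at hb'
    exact hij (Fin.ext hb'.1.symm)

theorem endDart_inj {T : PlaneTree} {x y : ℕ} (hx : x ≤ T.numLeaves) (hy : y ≤ T.numLeaves)
    (h : T.endDart x = T.endDart y) : x = y := by
  rw [← length_leaves] at hx hy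
  rcases x with _ | x <;> rcases y with _ | y <;> simp only [endDart, reduceCtorEq,
    Dart.down.injEq] at h ⊢
  · rw [List.getD_eq_getElem _ _ hx, List.getD_eq_getElem _ _ hy] at h
    rw [(nodup_leaves T).getElem_inj_iff.1 h]

/-- Steps are deterministic, so of two paths with a common start one continues the other; but no
step leaves an end dart. -/
theorem reflTransGen_endDart_unique {T : PlaneTree} {d : Dart} {x y : ℕ} (hx : x ≤ T.numLeaves)
    (hy : y ≤ T.numLeaves) (h₁ : Relation.ReflTransGen T.TripStep d (T.endDart x))
    (h₂ : Relation.ReflTransGen T.TripStep d (T.endDart y)) : x = y := by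
  rcases Relation.ReflTransGen.total_of_right_unique
    (fun _ _ _ h₁ h₂ => TripStep.unique h₁ h₂ : Relator.RightUnique T.TripStep) h₁ h₂ with h | h
  · rcases Relation.ReflTransGen.cases_head h with h | ⟨d', h, -⟩
    · exact endDart_inj hx hy h
    · exact absurd h (not_tripStep_endDart hx d')
  · rcases Relation.ReflTransGen.cases_head h with h | ⟨d', h, -⟩
    · exact (endDart_inj hy hx h).symm
    · exact absurd h (not_tripStep_endDart hy d')

theorem IsProper.ne_node_zero {T : PlaneTree} (hT : T.IsProper) (h : ℕ) (c : Fin 0 → PlaneTree) :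
    T ≠ node h 0 c := by
  rintro rfl
  exact absurd hT.1 (by decide)

theorem IsProper.isTripPerm_iff {T : PlaneTree} (hT : T.IsProper) {n : ℕ} (w : DecoratedPerm n) :
    T.IsTripPerm w ↔
      T.numLeaves + 1 = n ∧ (∀ i : Fin n, (w.perm i : ℕ) = T.trip i) ∧ w.white = ∅ := by
  rw [IsTripPerm, numBoundary, length_leaves]
  refine and_congr_right fun hn => and_congr ⟨fun h i => ?_, fun h i => ?_⟩ ?_
  · have h1 := hT.reflTransGen_trip (x := i) (by omega)
    exact reflTransGen_endDart_unique (by omega) (hT.isDerangement.le i (by omega)) (h i) h1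
  · rw [h i]
    exact hT.reflTransGen_trip (by omega)
  · rw [Finset.eq_empty_iff_forall_notMem]
    exact forall_congr' fun i => by simp [hT.ne_node_zero]

end PlaneTree

end GrassmannianTree
-- Rerooting and gluing: built permutations are the trip maps of trees
namespace GrassmannianTree

open Finset

namespace PlaneTree

theorem IsProper.trip_zero_pos {T : PlaneTree} (hT : T.IsProper) :
    1 ≤ T.trip 0 ∧ T.trip 0 ≤ T.numLeaves := by
  have h1 := hT.isDerangement.le 0 (Nat.zero_le _)
  have h2 := hT.isDerangement.ne 0 (Nat.zero_le _)
  omega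

theorem trip_node_zero {h m : ℕ} (hm : h ≤ m) (c : Fin m → PlaneTree) :
    (node h m c).trip 0 = offset (kid leaf c) h + ((kid leaf c h).trip 0 - 1) := by
  have := starTrip_apply h (kid leaf c) (z := 0) (Nat.succ_pos m) (by simp)
  rw [← trip_node, offset, off_zero, Nat.zero_add, Nat.zero_add, Nat.mod_eq_of_lt (by omega)] at this
  rw [this, kid_zero, if_pos (by simp [trip_leaf]), Nat.zero_add]

/-- The trip map of the tree that is obtained by joining the root edges of `U` and `T`. The leaves
of `U` come first, followed by the leaves of `T`. -/
def joinTrip (U T : PlaneTree) (x : ℕ) : ℕ :=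
  if x < U.numLeaves then
    if U.trip (x + 1) = 0 then U.numLeaves + (T.trip 0 - 1) else U.trip (x + 1) - 1
  else
    if T.trip (x - U.numLeaves + 1) = 0 then U.trip 0 - 1
    else U.numLeaves + (T.trip (x - U.numLeaves + 1) - 1)

theorem joinTrip_leaf_left {T : PlaneTree} (hT : T.IsProper) (x : ℕ) :
    joinTrip leaf T x = T.trip x := by
  have := hT.trip_zero_pos
  rcases x with _ | x
  · simp only [joinTrip, numLeaves_leaf, trip_leaf]
    simp only [zero_lt_one, if_true, Nat.zero_add, one_ne_zero, if_false]
    omega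
  · simp only [joinTrip, numLeaves_leaf, trip_leaf, Nat.add_sub_cancel]
    split_ifs <;> omega

/-- Gluing `U` to the root edge of a vertex makes `U` its branch number `0`, in the place of the
leaf that stood for the root. -/
theorem joinTrip_node {U : PlaneTree} {h m : ℕ} {c : Fin m → PlaneTree} (hU : U.IsProper)
    (hT : (node h m c).IsProper) {x : ℕ} (hx : x < U.numLeaves + (node h m c).numLeaves) :
    joinTrip U (node h m c) x = starTrip h (m + 1) (kid U c) x := by
  have hU0 := hU.trip_zero_pos
  obtain ⟨-, h1, hm, hc⟩ := id hT
  have hs : ∀ i < m, kid U c (i + 1) = kid leaf c (i + 1) := fun i hi => by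
    rw [kid_succ _ _ hi, kid_succ _ _ hi]
  set o : ℕ → ℕ := off fun e => (kid leaf c (e + 1)).numLeaves with ho
  have o1 : ∀ i, offset (kid leaf c) (i + 1) = 1 + o i := fun i => off_succ' _ i
  have o2 : ∀ i ≤ m, offset (kid U c) (i + 1) = U.numLeaves + o i := fun i hi => by
    rw [offset, off_succ', ho, off_congr (e := i)]
    · rfl
    · intro j hj
      rw [hs j (by omega)]
  have hn := numLeaves_node h m c
  rw [o1] at hn
  obtain ⟨e, he, z, hz, rfl⟩ := exists_offset (t := kid U c) (d := m + 1) (x := x)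
    (by rw [o2 m le_rfl]; omega)
  rw [starTrip_apply _ _ he hz]
  rcases e with _ | i
  · have hz' : z < U.numLeaves := hz
    simp only [kid_zero, off_zero, Nat.zero_add] at *
    rw [joinTrip, if_pos hz']
    split_ifs with hv
    · have t0 := trip_node_zero hm c
      obtain ⟨j, rfl⟩ : ∃ j, h = j + 1 := ⟨h - 1, by omega⟩
      rw [o1] at t0
      rw [t0, Nat.mod_eq_of_lt (by omega), o2 j (by omega), hs j (by omega)]
      omega
    · rfl
  · have him : i < m := by omega
    rw [hs i him] at hz ⊢
    have t0 := starTrip_apply h (kid leaf c) he hz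
    rw [← trip_node, o1] at t0
    rw [o2 i him.le] at hx ⊢
    rw [joinTrip, if_neg (by omega), show U.numLeaves + o i + z - U.numLeaves + 1 = 1 + o i + z by
      omega, t0]
    by_cases hv : (kid leaf c (i + 1)).trip (z + 1) = 0
    · simp only [hv, if_true]
      have hlt : (i + 1 + h) % (m + 1) < m + 1 := Nat.mod_lt _ (Nat.succ_pos m)
      rcases hj : (i + 1 + h) % (m + 1) with _ | j
      · simp [trip_leaf]
      · rw [o1, o2 j (by omega), hs j (by omega), if_neg (by omega)]
        omega
    · simp only [hv, if_false]
      rw [if_neg (by omega)]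
      omega

/-- The same unrooted tree as in `joinTrip_node`, cut at the last edge of the vertex instead of at
the edge to `U`. Rotating the edge labels by one does not affect the turning rule. Together the two
lemmas move the cut across a vertex. -/
theorem joinTrip_node_cons {U : PlaneTree} {h k : ℕ} {c : Fin (k + 1) → PlaneTree}
    (hT : (node h (k + 1) c).IsProper) {x : ℕ} (hx : x < U.numLeaves + (node h (k + 1) c).numLeaves) :
    joinTrip (node h (k + 1) (Fin.cons U fun i => c i.castSucc)) (c (Fin.last k)) x =
      starTrip h (k + 2) (kid U c) x := by
  obtain ⟨-, h1, hm, hc⟩ := id hT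
  set c' : Fin (k + 1) → PlaneTree := Fin.cons U fun i => c i.castSucc with hc'
  have hs : ∀ i ≤ k, kid leaf c' (i + 1) = kid U c i := fun i hi => by
    rw [kid_succ _ _ (by omega)]
    rcases i with _ | i
    · rfl
    · rw [kid_succ _ _ (by omega)]
      rfl
  have ht : kid U c (k + 1) = c (Fin.last k) := kid_succ _ _ (by omega)
  have o1 : ∀ i ≤ k + 1, offset (kid leaf c') (i + 1) = 1 + offset (kid U c) i := fun i hi => by
    rw [offset, off_succ', off_congr (e := i)]
    · rfl
    · intro j hj
      rw [hs j (by omega)]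
  have hn : (node h (k + 1) c').numLeaves = offset (kid U c) (k + 1) := by
    have := numLeaves_node h (k + 1) c'
    rw [o1 _ le_rfl] at this
    omega
  have hn' := numLeaves_node h (k + 1) c
  rw [offset_kid, numLeaves_leaf] at hn'
  obtain ⟨e, he, z, hz, rfl⟩ := exists_offset (t := kid U c) (d := k + 2) (x := x)
    (by rw [offset_kid]; omega)
  rw [starTrip_apply _ _ he hz]
  rcases Nat.lt_succ_iff_lt_or_eq.1 he with hek | rfl
  · have := off_add_le (fun e => (kid U c e).numLeaves) hek
    rw [joinTrip, if_pos (by rw [hn]; simp only [offset]; omega)]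
    have t0 := starTrip_apply h (kid leaf c') (e := e + 1) (d := k + 2) (z := z) (by omega)
      (by rwa [hs e (by omega)])
    rw [← trip_node, hs e (by omega), o1 e hek.le, show 1 + offset (kid U c) e + z =
      offset (kid U c) e + z + 1 by omega] at t0
    rw [t0]
    by_cases hv : (kid U c e).trip (z + 1) = 0
    · simp only [hv, if_true]
      have hlt : (e + h) % (k + 2) < k + 2 := Nat.mod_lt _ (by omega)
      have hmod : (e + 1 + h) % (k + 2) = ((e + h) % (k + 2) + 1) % (k + 2) := by
        rw [Nat.mod_add_mod]; congr 1; omega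
      by_cases hlast : (e + h) % (k + 2) = k + 1
      · rw [hmod, hlast, Nat.mod_self, hn, ht]
        simp [trip_leaf]
      · rw [hmod, Nat.mod_eq_of_lt (a := (e + h) % (k + 2) + 1) (by omega),
          o1 _ (by omega), hs _ (by omega), if_neg (by omega)]
        omega
    · simp only [hv, if_false]
      rw [if_neg (by omega)]
      omega
  · rw [joinTrip, if_neg (by omega), hn, Nat.add_sub_cancel_left, ← ht]
    by_cases hv : (kid U c (k + 1)).trip (z + 1) = 0
    · simp only [hv, if_true]
      have t0 := trip_node_zero hm c'
      obtain ⟨j, rfl⟩ : ∃ j, h = j + 1 := ⟨h - 1, by omega⟩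
      rw [o1 _ (by omega), hs _ (by omega)] at t0
      rw [t0, show k + 1 + (j + 1) = j + (k + 2) by omega, Nat.add_mod_right,
        Nat.mod_eq_of_lt (by omega)]
      omega
    · simp only [hv, if_false]

theorem IsProper.cons_init {U : PlaneTree} {h k : ℕ} {c : Fin (k + 1) → PlaneTree}
    (hU : U.IsProper) (hT : (node h (k + 1) c).IsProper) :
    (node h (k + 1) (Fin.cons U fun i => c i.castSucc)).IsProper :=
  ⟨hT.1, hT.2.1, hT.2.2.1, fun i => Fin.cases hU (fun _ => hT.2.2.2 _) i⟩

theorem numLeaves_cons_init (U : PlaneTree) (h k : ℕ) (c : Fin (k + 1) → PlaneTree) :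
    (node h (k + 1) (Fin.cons U fun i => c i.castSucc)).numLeaves + (c (Fin.last k)).numLeaves =
      U.numLeaves + (node h (k + 1) c).numLeaves := by
  simp only [numLeaves]
  rw [Fin.sum_univ_succ, Fin.sum_univ_castSucc (n := k) (f := fun i => (c i).numLeaves)]
  simp [add_assoc]

/-- The root can be moved to the last leaf. -/
theorem exists_joinTrip_leaf {U T : PlaneTree} (hU : U.IsProper) (hT : T.IsProper) :
    ∃ V : PlaneTree, V.IsProper ∧ V.numLeaves + 1 = U.numLeaves + T.numLeaves ∧
      ∀ x < U.numLeaves + T.numLeaves, joinTrip U T x = joinTrip V leaf x := by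
  induction T generalizing U with
  | leaf => exact ⟨U, hU, rfl, fun _ _ => rfl⟩
  | node h m c ih =>
    obtain ⟨k, rfl⟩ : ∃ k, m = k + 1 := ⟨m - 1, by have := hT.1; omega⟩
    -- The cut moves to the edge of the last child; all the rest of the tree becomes the left part,
    -- and the induction continues inside that child.
    obtain ⟨V, hV, hVn, hVt⟩ := ih (Fin.last k) (hU.cons_init hT) (hT.2.2.2 _)
    rw [numLeaves_cons_init] at hVn hVt
    exact ⟨V, hV, hVn, fun x hx => by
      rw [joinTrip_node hU hT hx, ← joinTrip_node_cons hT hx, hVt x hx]⟩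

/-- In `joinTrip V leaf` the root of `V` is the last boundary vertex, in `V.trip` it is the first.
Hence the two maps are conjugate by the cyclic shift. -/
theorem IsProper.trip_rotate {V : PlaneTree} (hV : V.IsProper) {x : ℕ} (hx : x ≤ V.numLeaves) :
    V.trip (if x = V.numLeaves then 0 else x + 1) =
      if joinTrip V leaf x = V.numLeaves then 0 else joinTrip V leaf x + 1 := by
  have h0 := hV.trip_zero_pos
  by_cases hxl : x = V.numLeaves
  · subst hxl
    simp only [joinTrip, lt_irrefl, if_false, if_true, trip_leaf, Nat.sub_self, Nat.zero_add,
      one_ne_zero]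
    split_ifs <;> omega
  · have := hV.isDerangement.le (x + 1) (by omega)
    simp only [joinTrip, hxl, if_false, if_pos (show x < V.numLeaves by omega), trip_leaf, if_true]
    split_ifs <;> omega

/-- The self-map `π` of `Fin n` is the trip map of a proper tree with at least three boundary
vertices. -/
def IsTripMap {n : ℕ} (π : Fin n → Fin n) : Prop :=
  3 ≤ n ∧ ∃ T : PlaneTree, T.IsProper ∧ T.numLeaves + 1 = n ∧ ∀ i, (π i : ℕ) = T.trip i

end PlaneTree

open PlaneTree

theorem coe_finRotate_ite {n : ℕ} (i : Fin (n + 1)) :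
    (finRotate (n + 1) i : ℕ) = if (i : ℕ) = n then 0 else (i : ℕ) + 1 := by
  rw [coe_finRotate]
  simp [Fin.ext_iff]

theorem cyc_finRotate {n : ℕ} (π : Fin n → Fin n) (i : Fin n) :
    cyc π (finRotate n i) = finRotate n (π i) := by
  simp only [cyc, Equiv.symm_apply_apply]

theorem iterate_cyc {n : ℕ} (π : Fin n → Fin n) (k : ℕ) (i : Fin n) :
    cyc^[k] π ((finRotate n ^ k) i) = (finRotate n ^ k) (π i) := by
  induction k with
  | zero => simp
  | succ k ih =>
    rw [Function.iterate_succ_apply', pow_succ', Equiv.Perm.mul_apply, cyc_finRotate, ih,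
      Equiv.Perm.mul_apply]

/-- Any class closed under `cyc` is therefore also closed under its inverse, which is `n - 1`
further rotations. -/
theorem iterate_cyc_self {n : ℕ} (hn : 2 ≤ n) (π : Fin n → Fin n) : cyc^[n] π = π := by
  obtain ⟨k, rfl⟩ : ∃ k, n = k + 2 := ⟨n - 2, by omega⟩
  have h : finRotate (k + 2) ^ (k + 2) = 1 := by
    have := pow_orderOf_eq_one (finRotate (k + 2))
    rwa [isCycle_finRotate.orderOf, support_finRotate, card_univ, Fintype.card_fin] at this
  funext i
  have := iterate_cyc π (k + 2) i
  rwa [h] at this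

theorem iterate_cyc_closed {n : ℕ} {p : (Fin n → Fin n) → Prop} (hp : ∀ π, p π → p (cyc π))
    {π : Fin n → Fin n} (hπ : p π) (k : ℕ) : p (cyc^[k] π) := by
  induction k with
  | zero => exact hπ
  | succ k ih => rw [Function.iterate_succ_apply']; exact hp _ ih

theorem isTripMap_cyc {n : ℕ} {π : Fin n → Fin n} (hπ : IsTripMap π) : IsTripMap (cyc π) := by
  obtain ⟨hn, T, hT, rfl, hπT⟩ := hπ
  obtain ⟨V, hV, hVn, hVt⟩ := exists_joinTrip_leaf (U := leaf) trivial hT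
  simp only [joinTrip_leaf_left hT, numLeaves_leaf] at hVn hVt
  have hVl : V.numLeaves = T.numLeaves := by omega
  refine ⟨hn, V, hV, by omega, fun i => ?_⟩
  obtain ⟨j, rfl⟩ := (finRotate _).surjective i
  have := hV.trip_rotate (x := j) (by omega)
  rw [hVl, ← hVt j (by omega), ← hπT] at this
  rw [cyc_finRotate, coe_finRotate_ite, coe_finRotate_ite, this]

theorem isTripMap_of_isTripMap_cyc {n : ℕ} {π : Fin n → Fin n} (hπ : IsTripMap (cyc π)) :
    IsTripMap π := by
  have h3 := hπ.1
  have := iterate_cyc_closed (p := IsTripMap) (fun _ => isTripMap_cyc) hπ (n - 1)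
  rwa [← Function.iterate_succ_apply, show (n - 1).succ = n by omega,
    iterate_cyc_self (by omega)] at this

theorem isTripMap_grassPerm {k n : ℕ} (hn : 3 ≤ n) (hk : 1 ≤ k) (hkn : k ≤ n - 1) :
    IsTripMap (grassPerm k n) := by
  obtain ⟨m, rfl⟩ : ∃ m, n = m + 1 := ⟨n - 1, by omega⟩
  refine ⟨hn, node k m fun _ => leaf, ⟨by omega, hk, by omega, fun _ => trivial⟩,
    by simp [numLeaves], fun i => ?_⟩
  have hkid : kid leaf (fun _ : Fin m => leaf) = fun _ => leaf := by
    funext e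
    exact kid_forall (p := fun T => T = leaf) _ _ rfl (fun _ => rfl) e
  have ho : ∀ e, offset (fun _ => leaf) e = e := fun e => by simp [offset, off]
  have := starTrip_apply k (kid leaf (fun _ : Fin m => leaf)) (z := 0) i.isLt (by simp [hkid])
  rw [trip_node]
  simp only [hkid] at this ⊢
  simpa [ho, trip_leaf, grassPerm] using this.symm

/-- The merged letters, the last of `σ` and the first of `τ`, are the two root edges that are glued.
This is why `σ` is presented with its root last. -/
theorem amalgamate_eq_joinTrip {m n : ℕ} {σ : Fin (m + 2) → Fin (m + 2)}
    {τ : Fin (n + 2) → Fin (n + 2)} {U T : PlaneTree} (hU : U.IsProper) (hT : T.IsProper)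
    (hUm : U.numLeaves = m + 1) (hσ : ∀ i, (σ i : ℕ) = joinTrip U leaf i)
    (hτ : ∀ i, (τ i : ℕ) = T.trip i) (i : Fin (m + n + 2)) :
    (amalgamate σ τ i : ℕ) = joinTrip U T i := by
  have hT0 := hT.trip_zero_pos
  have hU0 := hU.trip_zero_pos
  have e1 : ∀ j : Fin (m + 2), σ j = Fin.last (m + 1) ↔ joinTrip U leaf j = m + 1 := fun j => by
    rw [← hσ, Fin.ext_iff]; rfl
  have e2 : ∀ j : Fin (n + 2), τ j = 0 ↔ T.trip j = 0 := fun j => by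
    rw [← hτ, Fin.ext_iff]; rfl
  simp only [amalgamate, e1, e2]
  split_ifs with h1 h2 h2
  · simp only [hτ, Fin.val_zero]
    simp only [joinTrip, hUm, h1, if_true, trip_leaf] at h2 ⊢
    have := hU.isDerangement.le (i + 1) (by omega)
    split_ifs at h2 ⊢ <;> omega
  · simp only [hσ]
    simp only [joinTrip, hUm, h1, if_true, trip_leaf] at h2 ⊢
    split_ifs at h2 ⊢ <;> omega
  · simp only [hσ, Fin.val_last]
    have hi : (i : ℕ) - m = i - (m + 1) + 1 := by omega
    rw [hi] at h2
    simp [joinTrip, hUm, h1, trip_leaf, h2]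
  · simp only [hτ]
    have hi : (i : ℕ) - m = i - (m + 1) + 1 := by omega
    rw [hi] at h2 ⊢
    simp only [joinTrip, hUm, h1, if_false, h2]
    omega

theorem isTripMap_amalgamate {m n : ℕ} {σ : Fin (m + 2) → Fin (m + 2)}
    {τ : Fin (n + 2) → Fin (n + 2)} (hσ : IsTripMap σ) (hτ : IsTripMap τ) :
    IsTripMap (amalgamate σ τ) := by
  obtain ⟨hm, S, hS, hSm, hσS⟩ := hσ
  obtain ⟨hn, T, hT, hTn, hτT⟩ := hτ
  obtain ⟨U, hU, hUn, hUt⟩ := exists_joinTrip_leaf (U := leaf) trivial hS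
  simp only [joinTrip_leaf_left hS, numLeaves_leaf] at hUn hUt
  obtain ⟨V, hV, hVn, hVt⟩ := exists_joinTrip_leaf hU hT
  have key : ∀ i, (amalgamate σ τ i : ℕ) = joinTrip V leaf i := fun i => by
    rw [amalgamate_eq_joinTrip hU hT (by omega)
      (fun j => by rw [hσS, hUt j (by omega)]) hτT, hVt i (by omega)]
  -- The amalgamation is `joinTrip V leaf`, with the root of `V` last; one rotation turns it into
  -- `V.trip`.
  refine isTripMap_of_isTripMap_cyc ⟨by omega, V, hV, by omega, fun i => ?_⟩
  obtain ⟨j, rfl⟩ := (finRotate _).surjective i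
  have hVl : V.numLeaves = m + n + 1 := by omega
  have := hV.trip_rotate (x := j) (by omega)
  rw [hVl] at this
  rw [cyc_finRotate, coe_finRotate_ite, coe_finRotate_ite, this, key]

theorem IsBuilt.isTripMap {n : ℕ} {π : Fin n → Fin n} (hπ : IsBuilt π) : IsTripMap π := by
  induction hπ with
  | grassPerm k n hn hk hkn => exact isTripMap_grassPerm hn hk hkn
  | amalgamate σ τ _ _ h₁ h₂ => exact isTripMap_amalgamate h₁ h₂
  | cyc π _ h => exact isTripMap_cyc h

/-! ### Trip maps of trees are built from the `π_{k,n}` -/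

theorem exists_isBuilt_cyc_eq {n : ℕ} {π : Fin n → Fin n} (hπ : IsBuilt π) :
    ∃ π', IsBuilt π' ∧ cyc π' = π := by
  have hn := hπ.isTripMap.1
  refine ⟨cyc^[n - 1] π, iterate_cyc_closed (p := IsBuilt) (fun π => IsBuilt.cyc π) hπ _, ?_⟩
  rw [← Function.iterate_succ_apply' GrassmannianTree.cyc (n - 1) π, show (n - 1).succ = n by omega,
    iterate_cyc_self (by omega)]

namespace PlaneTree

/-- The tree is a leaf or its trip map is built from the `π_{k,n}`. -/
def IsLeafOrBuilt (T : PlaneTree) : Prop :=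
  T = leaf ∨ ∀ π : Fin (T.numLeaves + 1) → Fin (T.numLeaves + 1),
    (∀ i, (π i : ℕ) = T.trip i) → IsBuilt π

theorem isBuilt_of_joinTrip {U T : PlaneTree} (hU : U.IsProper) (hT : T.IsProper)
    (hUne : U ≠ leaf) (hUb : U.IsLeafOrBuilt) (hTb : T.IsLeafOrBuilt) {n : ℕ}
    (hn : n = U.numLeaves + T.numLeaves) (π : Fin n → Fin n)
    (hπ : ∀ i, (π i : ℕ) = joinTrip U T i) : IsBuilt π := by
  have toPerm : ∀ {T : PlaneTree}, T.IsProper → ∃ π : Fin (T.numLeaves + 1) →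
      Fin (T.numLeaves + 1), ∀ i, (π i : ℕ) = T.trip i := fun {T} hT =>
    ⟨fun i => ⟨T.trip i, Nat.lt_succ_of_le (hT.isDerangement.le _ (Nat.lt_succ_iff.1 i.isLt))⟩,
      fun i => rfl⟩
  obtain ⟨ρ, hρ⟩ := toPerm hU
  -- Rotating the trip map of `U` backwards puts its root last, as the left factor of an
  -- amalgamation requires.
  obtain ⟨σ, hσ, rfl⟩ := exists_isBuilt_cyc_eq (hUb.resolve_left hUne ρ hρ)
  have hσU : ∀ i, (σ i : ℕ) = joinTrip U leaf i := fun i => by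
    have h1 := hρ (finRotate _ i)
    have h2 := hU.trip_rotate (x := i) (by omega)
    rw [cyc_finRotate, coe_finRotate_ite, coe_finRotate_ite, h2] at h1
    have h3 := (σ i).isLt
    split_ifs at h1 <;> omega
  rcases eq_or_ne T leaf with rfl | hTne
  · rw [numLeaves_leaf] at hn
    subst hn
    rwa [show π = σ from funext fun i => Fin.ext ((hπ i).trans (hσU i).symm)]
  · obtain ⟨τ, hτ⟩ := toPerm hT
    have hτb := hTb.resolve_left hTne τ hτ
    obtain ⟨a, ha⟩ : ∃ a, U.numLeaves = a + 1 :=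
      ⟨U.numLeaves - 1, by have := hU.one_le_numLeaves; omega⟩
    obtain ⟨b, hb⟩ : ∃ b, T.numLeaves = b + 1 :=
      ⟨T.numLeaves - 1, by have := hT.one_le_numLeaves; omega⟩
    obtain rfl : n = a + b + 2 := by omega
    clear hρ
    generalize hUl : U.numLeaves = l at σ
    generalize hTl : T.numLeaves = l' at τ
    obtain rfl : l = a + 1 := by omega
    obtain rfl : l' = b + 1 := by omega
    rw [show π = amalgamate σ τ from funext fun i => Fin.ext (by
      rw [hπ, amalgamate_eq_joinTrip hU hT ha hσU hτ])]
    exact IsBuilt.amalgamate σ τ hσ hτb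

/-- Induction on `i`, the number of last children that may differ from leaves. The last child is cut
off as the right factor of an amalgamation, and a leaf enters in front as the new first child. The
degree and helicity of the vertex do not change, so for `i = 0` the trip map is `π_{h,m+1}`. -/
theorem isLeafOrBuilt_node {h m : ℕ} (i : ℕ) (c : Fin m → PlaneTree)
    (hT : (node h m c).IsProper) (hc : ∀ i, (c i).IsLeafOrBuilt)
    (hi : ∀ j : Fin m, (j : ℕ) + i < m → c j = leaf) : (node h m c).IsLeafOrBuilt := by
  obtain ⟨k, rfl⟩ : ∃ k, m = k + 1 := ⟨m - 1, by have := hT.1; omega⟩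
  right
  induction i generalizing c with
  | zero =>
    have hcl : c = fun _ => leaf := funext fun j => hi j (by omega)
    subst hcl
    intro π hπ
    obtain ⟨h2, h1, hm, -⟩ := hT
    have hn : (node h (k + 1) fun _ => leaf).numLeaves = k + 1 := by simp [numLeaves]
    revert π
    rw [hn]
    intro π hπ
    have : π = grassPerm h (k + 2) := by
      funext i
      apply Fin.ext
      rw [hπ, trip_node]
      have hkid : kid leaf (fun _ : Fin (k + 1) => leaf) = fun _ => leaf := by
        funext e
        exact kid_forall (p := fun T => T = leaf) _ _ rfl (fun _ => rfl) e
      have ho : ∀ e, offset (fun _ => leaf) e = e := fun e => by simp [offset, off]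
      have := starTrip_apply h (kid leaf (fun _ : Fin (k + 1) => leaf)) (z := 0) i.isLt
        (by simp [hkid])
      simp only [hkid] at this ⊢
      simpa [ho, trip_leaf, grassPerm] using this
    rw [this]
    exact IsBuilt.grassPerm h (k + 2) (by omega) h1 (by omega)
  | succ i ih =>
    intro π hπ
    have hU := IsProper.cons_init (U := leaf) trivial hT
    refine isBuilt_of_joinTrip hU (hT.2.2.2 (Fin.last k)) (by simp) (Or.inr ?_) (hc _)
      (by rw [numLeaves_cons_init, numLeaves_leaf, add_comm]) π fun j => ?_
    · refine ih _ hU (fun j => Fin.cases (Or.inl rfl) (fun j => hc _) j) fun j => ?_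
      refine Fin.cases (fun _ => rfl) (fun j hj => ?_) j
      rw [Fin.cons_succ]
      exact hi _ (by simp at hj ⊢; omega)
    · rw [hπ, joinTrip_node_cons (U := leaf) hT (by rw [numLeaves_leaf]; omega), ← trip_node]

theorem IsProper.isLeafOrBuilt {T : PlaneTree} (hT : T.IsProper) : T.IsLeafOrBuilt := by
  induction T with
  | leaf => exact Or.inl rfl
  | node h m c ih =>
    exact isLeafOrBuilt_node m c hT (fun i => ih i (hT.2.2.2 i)) fun j hj => by omega

end PlaneTree

end GrassmannianTree
-- Moves that preserve trips and dimension, and the existence of normal forms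
namespace GrassmannianTree

open Finset

namespace PlaneTree

/-- Two trees are equivalent if they have the same trips and the same dimension. -/
structure Equivalent (S T : PlaneTree) : Prop where
  numLeaves : S.numLeaves = T.numLeaves
  trip : ∀ x ≤ S.numLeaves, S.trip x = T.trip x
  sumVertexDim : S.sumVertexDim = T.sumVertexDim

theorem Equivalent.refl (T : PlaneTree) : Equivalent T T := ⟨rfl, fun _ _ => rfl, rfl⟩

theorem Equivalent.symm {S T : PlaneTree} (h : Equivalent S T) : Equivalent T S :=
  ⟨h.1.symm, fun x hx => (h.2 x (h.1 ▸ hx)).symm, h.3.symm⟩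

theorem Equivalent.trans {S T U : PlaneTree} (h : Equivalent S T) (h' : Equivalent T U) :
    Equivalent S U :=
  ⟨h.1.trans h'.1, fun x hx => (h.2 x hx).trans (h'.2 x (h.1 ▸ hx)), h.3.trans h'.3⟩

theorem Equivalent.node {h m : ℕ} {c c' : Fin m → PlaneTree} (hc : ∀ i, Equivalent (c i) (c' i)) :
    Equivalent (node h m c) (node h m c') := by
  have hk : ∀ e, Equivalent (kid leaf c e) (kid leaf c' e) := fun e => by
    rcases e with _ | i
    · exact Equivalent.refl _
    · by_cases hi : i < m
      · rw [kid_succ _ _ hi, kid_succ _ _ hi]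
        exact hc _
      · simp [kid, hi, Equivalent.refl]
  refine ⟨sum_congr rfl fun i _ => (hc i).1, fun x hx => ?_, ?_⟩
  · rw [trip_node, trip_node]
    refine star_congr (d := m + 1) (by omega) (fun e _ => (hk e).1) (fun e _ z hz => (hk e).2 z hz) ?_
    have := numLeaves_node h m c
    simp only [offset] at this
    omega
  · simp only [PlaneTree.sumVertexDim]
    rw [sum_congr rfl fun i _ => (hc i).3]

/-- A trivalent tree at the root; it is white for `k = 1` and black for `k = 2`. -/
def bin (k : ℕ) (a b : PlaneTree) : PlaneTree := node k 2 ![a, b]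

theorem Equivalent.bin {k : ℕ} {a a' b b' : PlaneTree} (ha : Equivalent a a')
    (hb : Equivalent b b') : Equivalent (bin k a b) (bin k a' b') := by
  refine Equivalent.node fun i => ?_
  fin_cases i
  · exact ha
  · exact hb

/-- A vertex with helicity `h` and degree `m + 1` is white (`k = 1`) or black (`k = 2`). -/
def IsColour (k h m : ℕ) : Prop := k = 1 ∧ h = 1 ∨ k = 2 ∧ h = m

theorem IsColour.vertexDim {k h m : ℕ} (hk : IsColour k h m) :
    vertexDim h (m + 1) = m := by
  rw [PlaneTree.vertexDim, if_pos (by rcases hk with ⟨-, h⟩ | ⟨-, h⟩ <;> omega)]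
  omega

/-- A white vertex sends every trip to the next edge, a black one to the previous edge. A trip that
turns at both ends of an edge between equal colours therefore leaves through the next, or previous,
edge around the contracted vertex. Dimensions agree because a coloured vertex contributes its number
of children minus `1`. -/
theorem equivalent_contract_right {k h h' m : ℕ} (hm : 1 ≤ m) (hh : IsColour k h m)
    (hh' : IsColour k h' (m + 1)) (a : PlaneTree) (c : Fin m → PlaneTree) :
    Equivalent (node h' (m + 1) (Fin.cons a c)) (bin k a (node h m c)) := by
  have hk2 : IsColour k k 2 := by rcases hh with h | h <;> simp [IsColour, h]
  set s := kid leaf (Fin.cons a c : Fin (m + 1) → PlaneTree) with hs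
  set y := kid leaf c with hy
  set t := kid leaf ![a, node h m c] with ht
  set o : ℕ → ℕ := off fun e => (y (e + 1)).numLeaves with ho
  have s1 : s 1 = a := rfl
  have t1 : t 1 = a := rfl
  have t2 : t 2 = node h m c := rfl
  have sy : ∀ i < m, s (i + 2) = y (i + 1) := fun i hi => by
    rw [hs, hy, kid_succ _ _ (by omega), kid_succ _ _ hi]; rfl
  have oy : ∀ i, offset y (i + 1) = 1 + o i := fun i => off_succ' _ i
  have os1 : offset s 1 = 1 := by simp [offset, off, hs]
  have os : ∀ i ≤ m, offset s (i + 2) = 1 + a.numLeaves + o i := fun i hi => by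
    rw [offset, off_succ', off_succ', ho, ← add_assoc, off_congr (e := i)]
    · rfl
    · intro j hj
      rw [sy j (by omega)]
  have ot1 : offset t 1 = 1 := by simp [offset, off, ht]
  have ot2 : offset t 2 = 1 + a.numLeaves := by
    simp [offset, off, ht, sum_range_succ, kid_succ]
  have hY := numLeaves_node h m c
  rw [← hy, oy] at hY
  have hS := numLeaves_node h' (m + 1) (Fin.cons a c)
  rw [← hs, os m le_rfl] at hS
  have hhm : 1 ≤ h ∧ h ≤ m := by rcases hh with h | h <;> omega
  -- A trip that comes down to the lower vertex turns into its edge `h`, which is edge `h + 1` of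
  -- the contracted vertex.
  have Y0 : offset t 2 + ((t 2).trip 0 - 1) = offset s (h + 1) + ((s (h + 1)).trip 0 - 1) := by
    obtain ⟨j, rfl⟩ : ∃ j, h = j + 1 := ⟨h - 1, by omega⟩
    rw [t2, trip_node_zero hhm.2 c, ← hy, oy, ot2, os j (by omega), sy j (by omega)]
    omega
  refine ⟨?_, fun x hx => ?_, ?_⟩
  · have hT := numLeaves_node k 2 ![a, node h m c]
    rw [offset_kid] at hT
    simp at hT
    rw [bin]
    omega
  · obtain ⟨e, he, z, hz, rfl⟩ := exists_offset (t := s) (d := m + 2) (x := x)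
      (by rw [os m le_rfl]; omega)
    rw [bin, trip_node, ← hs, starTrip_apply _ _ he hz]
    rcases e with _ | _ | i
    · obtain rfl : z = 0 := by simpa [hs] using hz
      have h0 : (s 0).trip (0 + 1) = 0 := rfl
      rw [if_pos h0, show offset s 0 + 0 = 0 from rfl, Nat.zero_add,
        trip_node_zero (by rcases hh with h | h <;> omega), ← ht]
      rcases hh with ⟨rfl, rfl⟩ | ⟨rfl, rfl⟩ <;> rcases hh' with ⟨hk, rfl⟩ | ⟨hk, rfl⟩
      · rw [Nat.mod_eq_of_lt (by omega), s1, t1, os1, ot1]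
      · omega
      · omega
      · rw [Y0, Nat.mod_eq_of_lt (by omega)]
    · have hz' : z < a.numLeaves := hz
      have := starTrip_apply k t (e := 1) (d := 3) (z := z) (by omega) hz'
      rw [Nat.zero_add, os1, s1]
      rw [ot1, t1] at this
      rw [trip_node, ← ht, this]
      refine if_congr Iff.rfl ?_ rfl
      rcases hh with ⟨rfl, rfl⟩ | ⟨rfl, rfl⟩ <;> rcases hh' with ⟨hk, rfl⟩ | ⟨hk, rfl⟩
      · rw [Nat.mod_eq_of_lt (by omega), Y0]
      · omega
      · omega
      · rw [show 1 + (h + 1) = h + 1 + 1 by omega, Nat.mod_self]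
        rfl
    · have him : i < m := by omega
      rw [sy i him] at hz ⊢
      have hY1 := starTrip_apply h y (e := i + 1) (d := m + 1) (z := z) (by omega) hz
      rw [← trip_node, oy] at hY1
      have hzl : o i + z < (node h m c).numLeaves := by
        have := off_add_le (fun e => (y (e + 1)).numLeaves) him
        simp only [← ho] at this
        omega
      have := starTrip_apply k t (e := 2) (d := 3) (z := o i + z) (by omega) hzl
      rw [ot2, t2, show o i + z + 1 = 1 + o i + z by omega, hY1] at this
      rw [os i him.le, trip_node, ← ht, show 1 + a.numLeaves + o i + z =
        1 + a.numLeaves + (o i + z) by omega, this]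
      by_cases hv : (y (i + 1)).trip (z + 1) = 0
      · simp only [hv, if_true]
        rcases hh with ⟨rfl, rfl⟩ | ⟨rfl, rfl⟩ <;> rcases hh' with ⟨hk, rfl⟩ | ⟨hk, rfl⟩
        · by_cases hlast : i + 1 = m
          · rw [show i + 1 + 1 = m + 1 by omega, Nat.mod_self, Nat.mod_self]
            simp [hs, hy, ht, trip_leaf]
          · rw [Nat.mod_eq_of_lt (by omega), Nat.mod_eq_of_lt (by omega), oy,
              if_neg (by omega), os _ (by omega), sy _ (by omega)]
            omega
        · omega
        · omega
        · rw [show i + 1 + h = i + (h + 1) by omega, Nat.add_mod_right,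
            show i + 2 + (h + 1) = i + 1 + (h + 2) by omega, Nat.add_mod_right,
            Nat.mod_eq_of_lt (by omega), Nat.mod_eq_of_lt (by omega)]
          rcases i with _ | i
          · simp [hy, trip_leaf, os1, ot1, s1, t1]
          · rw [oy, if_neg (by omega), os _ (by omega), sy _ (by omega)]
            omega
      · simp only [hv, if_false]
        rw [if_neg (by omega)]
        omega
  · simp only [sumVertexDim, bin, Fin.sum_univ_succ, hh'.vertexDim, hk2.vertexDim]
    simp [sumVertexDim, hh.vertexDim]
    omega

theorem joinTrip_congr {U U' T : PlaneTree} (h : Equivalent U U') (x : ℕ) :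
    joinTrip U T x = joinTrip U' T x := by
  simp only [joinTrip, ← h.1, ← h.2 0 (Nat.zero_le _)]
  by_cases hx : x < U.numLeaves
  · simp only [hx, if_true, ← h.2 (x + 1) hx]
  · simp only [hx, if_false]

theorem IsProper.bin {k : ℕ} (hk : k = 1 ∨ k = 2) {a b : PlaneTree} (ha : a.IsProper)
    (hb : b.IsProper) : (bin k a b).IsProper := by
  refine ⟨le_rfl, by omega, by omega, fun i => ?_⟩
  fin_cases i
  · exact ha
  · exact hb

/-- Both sides contract to one vertex of degree `4`. For the right comb this is the contraction
lemma itself; for the left comb the tree is first cut at the edge to `c`, where the edge to be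
contracted leads to a last child. -/
theorem equivalent_bin_assoc {k : ℕ} (hk : k = 1 ∨ k = 2) {a b c : PlaneTree} (ha : a.IsProper)
    (hb : b.IsProper) (hc : c.IsProper) :
    Equivalent (bin k a (bin k b c)) (bin k (bin k a b) c) := by
  obtain ⟨h, hh⟩ : ∃ h, IsColour k h 3 := by
    rcases hk with rfl | rfl
    · exact ⟨1, by simp [IsColour]⟩
    · exact ⟨3, by simp [IsColour]⟩
  have hk2 : IsColour k k 2 := by rcases hk with rfl | rfl <;> simp [IsColour]
  have e1 := equivalent_contract_right (by norm_num) hk2 hh a ![b, c]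
  have e2 := equivalent_contract_right (by norm_num) hk2 hh leaf ![a, b]
  have p1 : (node h 3 (Fin.cons a ![b, c])).IsProper := by
    refine ⟨by norm_num, ?_, ?_, fun i => ?_⟩
    · rcases hh with h | h <;> omega
    · rcases hh with h | h <;> omega
    · fin_cases i
      · exact ha
      · exact hb
      · exact hc
  have p2 := (IsProper.bin hk ha hb).bin hk hc
  refine e1.symm.trans ⟨?_, fun x hx => ?_, ?_⟩
  · simp [numLeaves, bin, Fin.sum_univ_succ]
    omega
  · have j1 := joinTrip_node_cons (U := leaf) p1 (x := x) (by rw [numLeaves_leaf]; omega)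
    have hl : (node h 3 (Fin.cons a ![b, c])).numLeaves = (bin k (bin k a b) c).numLeaves := by
      simp [numLeaves, bin, Fin.sum_univ_succ]
      omega
    have hx' : x ≤ (bin k (bin k a b) c).numLeaves := hl ▸ hx
    have j2 := joinTrip_node_cons (U := leaf) (k := 1) (c := ![bin k a b, c]) p2 (x := x)
      (show x < 1 + (bin k (bin k a b) c).numLeaves by omega)
    rw [← trip_node] at j1 j2
    rw [← j1, bin, ← j2]
    have c1 : (Fin.cons leaf fun i : Fin 2 => (Fin.cons a ![b, c] : Fin 3 → PlaneTree) i.castSucc :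
        Fin 3 → PlaneTree) = Fin.cons leaf ![a, b] := by
      funext i
      fin_cases i <;> rfl
    have c2 : (Fin.cons leaf fun i : Fin 1 => (![bin k a b, c] : Fin 2 → PlaneTree) i.castSucc :
        Fin 2 → PlaneTree) = ![leaf, bin k a b] := by
      funext i
      fin_cases i <;> rfl
    rw [c1, c2]
    exact joinTrip_congr e2 x
  · simp [sumVertexDim, bin, Fin.sum_univ_succ, hh.vertexDim, hk2.vertexDim]
    omega

/-! ### Normal forms -/

/-- The root vertex of the tree is white (`k = 1`) or black (`k = 2`). -/
def HasColour (k : ℕ) : PlaneTree → Prop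
  | leaf => False
  | node h m _ => IsColour k h m

/-- White and black vertices are trivalent, and are not joined to their last child by an edge whose
ends have the same colour. -/
def IsNormal : PlaneTree → Prop
  | leaf => True
  | node h m c => 2 ≤ m ∧ 1 ≤ h ∧ h ≤ m ∧
      (∀ k, IsColour k h m → m = 2 ∧ ∀ i : Fin m, i.val = 1 → ¬ (c i).HasColour k) ∧
      ∀ i, (c i).IsNormal

theorem IsNormal.isProper {T : PlaneTree} (hT : T.IsNormal) : T.IsProper := by
  induction T with
  | leaf => trivial
  | node h m c ih => exact ⟨hT.1, hT.2.1, hT.2.2.1, fun i => ih i (hT.2.2.2.2 i)⟩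

theorem isNormal_bin {k : ℕ} {a b : PlaneTree} :
    (bin k a b).IsNormal ↔ (k = 1 ∨ k = 2) ∧ a.IsNormal ∧ b.IsNormal ∧ ¬ b.HasColour k := by
  simp only [bin, IsNormal, Fin.forall_fin_two, IsColour]
  simp only [Matrix.cons_val_zero, Matrix.cons_val_one, Fin.val_zero, Fin.val_one]
  constructor
  · rintro ⟨-, h1, h2, h3, ha, hb⟩
    have hk : k = 1 ∨ k = 2 := by omega
    exact ⟨hk, ha, hb, (h3 k (by omega)).2.2 trivial⟩
  · rintro ⟨hk, ha, hb, hc⟩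
    refine ⟨le_rfl, by omega, by omega, fun k' hk' => ⟨trivial, by omega, fun _ => ?_⟩, ha, hb⟩
    obtain rfl : k' = k := by omega
    exact hc

theorem IsNormal.eq_bin {k : ℕ} {T : PlaneTree} (hT : T.IsNormal) (hk : T.HasColour k) :
    ∃ a b, T = bin k a b := by
  rcases T with _ | ⟨h, m, c⟩
  · exact hk.elim
  · obtain ⟨rfl, -⟩ := hT.2.2.2.1 k hk
    obtain rfl : h = k := by rcases hk with h | h <;> omega
    refine ⟨c 0, c 1, ?_⟩
    rw [bin]
    congr 1
    funext i
    fin_cases i <;> rfl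

/-- If `b` has the forbidden colour, it is `bin k b₀ b₁` and reassociation gives `bin k (bin k a b₀)
b₁`. Here `b₁` is allowed as a last child since `b` is normal, and the induction applies to `b₀`. -/
theorem exists_isNormal_bin {k : ℕ} (hk : k = 1 ∨ k = 2) {a b : PlaneTree} (ha : a.IsNormal)
    (hb : b.IsNormal) : ∃ T : PlaneTree, T.IsNormal ∧ Equivalent (bin k a b) T := by
  induction b generalizing a with
  | leaf => exact ⟨_, isNormal_bin.2 ⟨hk, ha, hb, fun h => h⟩, Equivalent.refl _⟩
  | node h m c ih =>
    by_cases hc : (node h m c).HasColour k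
    · obtain ⟨rfl, -⟩ := hb.2.2.2.1 k hc
      obtain rfl : h = k := by rcases hc with h | h <;> omega
      have h2 : node h 2 c = bin h (c 0) (c 1) := by
        rw [bin]
        congr 1
        funext i
        fin_cases i <;> rfl
      rw [h2] at hb ⊢
      have hb' := isNormal_bin.1 hb
      obtain ⟨T, hT, hTe⟩ := ih 0 ha hb'.2.1
      refine ⟨bin h T (c 1), isNormal_bin.2 ⟨hk, hT, hb'.2.2⟩, ?_⟩
      exact (equivalent_bin_assoc hk ha.isProper hb'.2.1.isProper hb'.2.2.1.isProper).trans
        (Equivalent.bin hTe (Equivalent.refl _))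
    · exact ⟨_, isNormal_bin.2 ⟨hk, ha, hb, hc⟩, Equivalent.refl _⟩

/-- Trivalent vertices are split off one at a time at the first child, and each result is brought
into normal form. -/
theorem exists_isNormal_node {k m h : ℕ} (hm : 2 ≤ m) (hh : IsColour k h m)
    (c : Fin m → PlaneTree) (hc : ∀ i, (c i).IsNormal) :
    ∃ T : PlaneTree, T.IsNormal ∧ Equivalent (node h m c) T := by
  have hk : k = 1 ∨ k = 2 := by rcases hh with h | h <;> omega
  induction m, hm using Nat.le_induction generalizing h with
  | base =>
    obtain rfl : h = k := by rcases hh with h | h <;> omega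
    have h2 : c = ![c 0, c 1] := by
      funext i
      fin_cases i <;> rfl
    rw [h2]
    exact exists_isNormal_bin hk (hc 0) (hc 1)
  | succ m hm ih =>
    obtain ⟨h', hh'⟩ : ∃ h', IsColour k h' m := by
      rcases hk with rfl | rfl
      · exact ⟨1, by simp [IsColour]⟩
      · exact ⟨m, by simp [IsColour]⟩
    obtain ⟨S, hS, hSe⟩ := ih hh' (fun i => c i.succ) (fun i => hc _)
    obtain ⟨T, hT, hTe⟩ := exists_isNormal_bin hk (hc 0) hS
    refine ⟨T, hT, ?_⟩
    have := equivalent_contract_right (by omega) hh' hh (c 0) (fun i => c i.succ)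
    rw [show (Fin.cons (c 0) fun i => c i.succ : Fin (m + 1) → PlaneTree) = c from
      Fin.cons_self_tail c] at this
    exact (this.trans (Equivalent.bin (Equivalent.refl _) hSe)).trans hTe

theorem IsProper.exists_isNormal {T : PlaneTree} (hT : T.IsProper) :
    ∃ S : PlaneTree, S.IsNormal ∧ Equivalent T S := by
  induction T with
  | leaf => exact ⟨leaf, trivial, Equivalent.refl _⟩
  | node h m c ih =>
    choose c' hc' hce using fun i => ih i (hT.2.2.2 i)
    by_cases hk : ∃ k, IsColour k h m
    · obtain ⟨k, hk⟩ := hk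
      obtain ⟨S, hS, hSe⟩ := exists_isNormal_node hT.1 hk c' hc'
      exact ⟨S, hS, (Equivalent.node hce).trans hSe⟩
    · exact ⟨node h m c', ⟨hT.1, hT.2.1, hT.2.2.1, fun k hk' => absurd ⟨k, hk'⟩ hk, hc'⟩,
        Equivalent.node hce⟩

end PlaneTree

end GrassmannianTree
-- Trips that leave a segment of leaves
namespace GrassmannianTree

open Finset

/-- A nontrivial rotation does not preserve a proper cyclic interval of edges: the edge carried to
`j + 1` leaves it, or the edge `1` if the rotation jumps over the interval. -/
theorem exists_add_mod_notMem {h m j : ℕ} (h1 : 1 ≤ h) (hm : h ≤ m) (hj : 1 ≤ j) (hjm : j ≤ m) :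
    ∃ e, 1 ≤ e ∧ e ≤ j ∧ ((e + h) % (m + 1) = 0 ∨ j < (e + h) % (m + 1)) := by
  by_cases hle : h ≤ j
  · refine ⟨j + 1 - h, by omega, by omega, ?_⟩
    rw [add_mod_eq (by omega) (by omega)]
    split_ifs <;> omega
  · refine ⟨1, le_rfl, hj, ?_⟩
    rw [add_mod_eq (by omega) (by omega)]
    split_ifs <;> omega

theorem exists_lt_add_mod {h m j : ℕ} (h1 : 1 ≤ h) (hm : h ≤ m) (hjm : j < m) :
    ∃ e ≤ j, j < (e + h) % (m + 1) := by
  by_cases hle : h ≤ j + 1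
  · exact ⟨j + 1 - h, by omega, by rw [Nat.mod_eq_of_lt (by omega)]; omega⟩
  · exact ⟨0, by omega, by rw [Nat.mod_eq_of_lt (by omega)]; omega⟩

/-- The interval and its complement both have at least two edges, and the rotation is by at least
two steps in either direction. So two edges leave: the first two if the rotation is long, and
otherwise those carried to `j + 1` and `j + 2`. -/
theorem exists_two_add_mod_notMem {h m i j : ℕ} (h2 : 2 ≤ h) (hm : h + 1 ≤ m) (hi : 1 ≤ i)
    (hij : i < j) (hj : j ≤ m) (hlen : j + 2 ≤ i + m) :
    ∃ e₁ e₂, i ≤ e₁ ∧ e₁ < e₂ ∧ e₂ ≤ j ∧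
      ((e₁ + h) % (m + 1) < i ∨ j < (e₁ + h) % (m + 1)) ∧
      ((e₂ + h) % (m + 1) < i ∨ j < (e₂ + h) % (m + 1)) := by
  have key : ∀ e, i ≤ e → e ≤ j → j < e + h → e + h < i + (m + 1) →
      ((e + h) % (m + 1) < i ∨ j < (e + h) % (m + 1)) := fun e h1 h2 h3 h4 => by
    rw [add_mod_eq (by omega) (by omega)]
    split_ifs <;> omega
  by_cases ha : j + 1 ≤ h + i
  · exact ⟨i, i + 1, le_rfl, by omega, by omega, key _ (by omega) (by omega) (by omega) (by omega),
      key _ (by omega) (by omega) (by omega) (by omega)⟩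
  · exact ⟨j + 1 - h, j + 2 - h, by omega, by omega, by omega,
      key _ (by omega) (by omega) (by omega) (by omega),
      key _ (by omega) (by omega) (by omega) (by omega)⟩

namespace PlaneTree

/-- The position of the end of a trip that enters the `e`-th tree through its root. -/
def entry (t : ℕ → PlaneTree) (e : ℕ) : ℕ := offset t e + ((t e).trip 0 - 1)

section node

variable {h m : ℕ} {c : Fin m → PlaneTree}

theorem trip_node_of_ne_zero {e z : ℕ} (he : e < m + 1) (hz : z < (kid leaf c e).numLeaves)
    (hv : (kid leaf c e).trip (z + 1) ≠ 0) :
    (node h m c).trip (offset (kid leaf c) e + z) =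
      offset (kid leaf c) e + ((kid leaf c e).trip (z + 1) - 1) := by
  rw [trip_node, starTrip_apply _ _ he hz, if_neg hv]

theorem trip_node_of_eq_zero {e z : ℕ} (he : e < m + 1) (hz : z < (kid leaf c e).numLeaves)
    (hv : (kid leaf c e).trip (z + 1) = 0) :
    (node h m c).trip (offset (kid leaf c) e + z) = entry (kid leaf c) ((e + h) % (m + 1)) := by
  rw [trip_node, starTrip_apply _ _ he hz, if_pos hv, entry]

theorem offset_one : offset (kid leaf c) 1 = 1 := by simp [offset, off]

theorem offset_add_one (e : ℕ) :
    offset (kid leaf c) (e + 1) = offset (kid leaf c) e + (kid leaf c e).numLeaves :=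
  off_succ _ e

theorem offset_mono {a b : ℕ} (hab : a ≤ b) : offset (kid leaf c) a ≤ offset (kid leaf c) b :=
  off_mono _ hab

theorem entry_zero : entry (kid leaf c) 0 = 0 := rfl

theorem IsProper.entry_bounds (hT : (node h m c).IsProper) (e : ℕ) :
    offset (kid leaf c) e ≤ entry (kid leaf c) e ∧
      entry (kid leaf c) e < offset (kid leaf c) (e + 1) := by
  have := (hT.kids (a := leaf) trivial e).trip_zero_pos
  rw [offset_add_one, entry]
  omega

theorem IsProper.exists_trip_eq_entry (hT : (node h m c).IsProper) {e : ℕ} (he : e < m + 1) :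
    ∃ z < (kid leaf c e).numLeaves, (kid leaf c e).trip (z + 1) = 0 ∧
      (node h m c).trip (offset (kid leaf c) e + z) =
        entry (kid leaf c) ((e + h) % (m + 1)) := by
  obtain ⟨z, hz, hv⟩ := (hT.kids (a := leaf) trivial e).isDerangement.exists_exit
  exact ⟨z, hz, hv, trip_node_of_eq_zero he hz hv⟩

/-- At most one trip leaves the leaves below a child of the root vertex. -/
theorem IsProper.exit_unique (hT : (node h m c).IsProper) {e x y : ℕ} (he : e < m + 1)
    (hx : offset (kid leaf c) e ≤ x) (hx' : x < offset (kid leaf c) (e + 1))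
    (hy : offset (kid leaf c) e ≤ y) (hy' : y < offset (kid leaf c) (e + 1))
    (hwx : (node h m c).trip x < offset (kid leaf c) e ∨
      offset (kid leaf c) (e + 1) ≤ (node h m c).trip x)
    (hwy : (node h m c).trip y < offset (kid leaf c) e ∨
      offset (kid leaf c) (e + 1) ≤ (node h m c).trip y) : x = y := by
  have hd := (hT.kids (a := leaf) trivial e).isDerangement
  have key : ∀ x, offset (kid leaf c) e ≤ x → x < offset (kid leaf c) (e + 1) →
      ((node h m c).trip x < offset (kid leaf c) e ∨
        offset (kid leaf c) (e + 1) ≤ (node h m c).trip x) →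
      (kid leaf c e).trip (x - offset (kid leaf c) e + 1) = 0 := by
    intro x hx hx' hw
    by_contra hv
    rw [offset_add_one] at hx' hw
    have := trip_node_of_ne_zero (h := h) he (z := x - offset (kid leaf c) e) (by omega) hv
    have h2 := hd.le (x - offset (kid leaf c) e + 1) (by omega)
    rw [Nat.add_sub_cancel' hx] at this
    omega
  have hx0 := key x hx hx' hwx
  have hy0 := key y hy hy' hwy
  rw [offset_add_one] at hx' hy'
  have := hd.inj _ (by omega) _ (by omega) (hx0.trans hy0.symm)
  omega

end node

/-- Some trip leaves every initial segment of the leaves. -/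
theorem IsProper.exists_exit_prefix {T : PlaneTree} (hT : T.IsProper) {p : ℕ} (hp : 1 ≤ p)
    (hpn : p ≤ T.numLeaves) : ∃ x, 1 ≤ x ∧ x ≤ p ∧ (T.trip x = 0 ∨ p < T.trip x) := by
  induction T generalizing p with
  | leaf =>
    obtain rfl : p = 1 := le_antisymm hpn hp
    exact ⟨1, le_rfl, le_rfl, Or.inl rfl⟩
  | node h m c ih =>
    have hn := numLeaves_node h m c
    obtain ⟨j, hj, r, hr, rfl⟩ := exists_offset (t := kid leaf c) (d := m + 1) (x := p) (by omega)
    have hj1 : 1 ≤ j := by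
      by_contra hj0
      obtain rfl : j = 0 := by omega
      obtain rfl : r = 0 := by simpa using hr
      simp [offset] at hp
    have hone := offset_one (c := c)
    have hins : ∃ x', 1 ≤ x' ∧ x' ≤ r + 1 ∧
        ((kid leaf c j).trip x' = 0 ∨ r + 1 < (kid leaf c j).trip x') := by
      obtain ⟨i, rfl⟩ : ∃ i, j = i + 1 := ⟨j - 1, by omega⟩
      rw [kid_succ _ _ (by omega)] at hr ⊢
      exact ih ⟨i, by omega⟩ (hT.2.2.2 _) (by omega) hr
    obtain ⟨x', hx1, hxr, hx'⟩ := hins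
    obtain ⟨z, rfl⟩ : ∃ z, x' = z + 1 := ⟨x' - 1, by omega⟩
    have hjo := offset_mono (c := c) hj1
    rcases hx' with hx' | hx'
    -- The last, partial block `j` also sends its exit to the root vertex from within the segment,
    -- so it may be treated as a full block.
    · obtain ⟨e, he1, hej, he⟩ := exists_add_mod_notMem hT.2.1 hT.2.2.1 hj1 (by omega)
      have heo := offset_mono (c := c) he1
      have hx : ∃ x, 1 ≤ x ∧ x ≤ offset (kid leaf c) j + r ∧
          (node h m c).trip x = entry (kid leaf c) ((e + h) % (m + 1)) := by
        rcases hej.lt_or_eq with hlt | rfl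
        · obtain ⟨z, hz, -, hz'⟩ := hT.exists_trip_eq_entry (e := e) (by omega)
          have := offset_mono (c := c) hlt
          rw [Nat.succ_eq_add_one, offset_add_one] at this
          exact ⟨_, by omega, by omega, hz'⟩
        · exact ⟨_, by omega, by omega, trip_node_of_eq_zero hj (by omega) hx'⟩
      obtain ⟨x, hx1, hxp, hxe⟩ := hx
      refine ⟨x, hx1, hxp, ?_⟩
      rw [hxe]
      rcases he with he | he
      · exact Or.inl (by rw [he, entry_zero])
      · have h1 := (hT.entry_bounds ((e + h) % (m + 1))).1
        have h2 := offset_mono (c := c) he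
        rw [Nat.succ_eq_add_one, offset_add_one] at h2
        exact Or.inr (by omega)
    · refine ⟨offset (kid leaf c) j + z, by omega, by omega, Or.inr ?_⟩
      rw [trip_node_of_ne_zero hj (by omega) (by omega)]
      omega

/-- Some trip leaves every initial segment of the boundary vertices that contains the root. -/
theorem IsProper.exists_exit_root_prefix {T : PlaneTree} (hT : T.IsProper) {p : ℕ}
    (hp : p < T.numLeaves) : ∃ x ≤ p, p < T.trip x := by
  induction T generalizing p with
  | leaf =>
    obtain rfl : p = 0 := by rw [numLeaves_leaf] at hp; omega
    exact ⟨0, le_rfl, Nat.one_pos⟩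
  | node h m c ih =>
    have hn := numLeaves_node h m c
    obtain ⟨j, hj, r, hr, rfl⟩ := exists_offset (t := kid leaf c) (d := m + 1) (x := p) (by omega)
    have key : ∀ i < m, i ≤ j → offset (kid leaf c) (i + 1) ≤ offset (kid leaf c) j + r + 1 →
        (∀ e', i < e' → offset (kid leaf c) j + r < entry (kid leaf c) e') →
        ∃ x ≤ offset (kid leaf c) j + r, offset (kid leaf c) j + r < (node h m c).trip x := by
      intro i him hij hio hi
      obtain ⟨e, hei, he⟩ := exists_lt_add_mod hT.2.1 hT.2.2.1 him
      obtain ⟨z, hz, -, hz'⟩ := hT.exists_trip_eq_entry (e := e) (by omega)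
      have h2 := offset_mono (c := c) (Nat.succ_le_succ hei)
      simp only [Nat.succ_eq_add_one, offset_add_one e] at h2
      exact ⟨offset (kid leaf c) e + z, by omega, by rw [hz']; exact hi _ he⟩
    rcases (Nat.succ_le_of_lt hr).lt_or_eq with hlt | heq
    · have hj1 : 1 ≤ j := by
        by_contra hj0
        obtain rfl : j = 0 := by omega
        simp at hlt
      obtain ⟨i, rfl⟩ : ∃ i, j = i + 1 := ⟨j - 1, by omega⟩
      obtain ⟨x, hx, hxr⟩ : ∃ x ≤ r + 1, r + 1 < (kid leaf c (i + 1)).trip x := by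
        rw [kid_succ _ _ (by omega)] at hlt ⊢
        exact ih ⟨i, by omega⟩ (hT.2.2.2 _) hlt
      rcases x with _ | z
      · refine key i (by omega) (by omega) (by omega) fun e' he' => ?_
        rcases (show i + 1 ≤ e' from he').lt_or_eq with h1 | rfl
        · have h2 := offset_mono (c := c) h1
          have h3 := (hT.entry_bounds e').1
          simp only [Nat.succ_eq_add_one, offset_add_one (i + 1)] at h2
          omega
        · simp only [entry]
          omega
      · refine ⟨offset (kid leaf c) (i + 1) + z, by omega, ?_⟩
        rw [trip_node_of_ne_zero hj (by omega) (by omega)]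
        omega
    · have hjm : j < m := by
        by_contra hjm
        obtain rfl : j = m := by omega
        rw [offset_add_one] at hn
        omega
      refine key j hjm le_rfl (by rw [offset_add_one]; omega) fun e' he' => ?_
      have h2 := offset_mono (c := c) he'
      have h3 := (hT.entry_bounds e').1
      simp only [Nat.succ_eq_add_one, offset_add_one j] at h2
      omega

/-- In a normal tree at least two trips leave a segment of leaves that consists of the leaves below
one or more children and of some of the first leaves below the next child, unless these are all
leaves. -/
theorem IsNormal.exists_two_exits {h m : ℕ} {c : Fin m → PlaneTree} (hT : (node h m c).IsNormal)
    {i j r : ℕ} (hi : 1 ≤ i) (hij : i < j) (hj : j ≤ m) (hr : r < (kid leaf c j).numLeaves)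
    (hall : i = 1 → offset (kid leaf c) j + r ≠ (node h m c).numLeaves) :
    ∃ x y, x ≠ y ∧
      (offset (kid leaf c) i ≤ x ∧ x ≤ offset (kid leaf c) j + r) ∧
      (offset (kid leaf c) i ≤ y ∧ y ≤ offset (kid leaf c) j + r) ∧
      ((node h m c).trip x < offset (kid leaf c) i ∨
        offset (kid leaf c) j + r < (node h m c).trip x) ∧
      ((node h m c).trip y < offset (kid leaf c) i ∨
        offset (kid leaf c) j + r < (node h m c).trip y) := by
  generalize hTeq : node h m c = T at hT
  induction T generalizing h m i j r with
  | leaf => cases hTeq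
  | node h m c ih =>
  cases hTeq
  have hP := hT.isProper
  have hn := numLeaves_node h m c
  have hone := offset_one (c := c)
  have hmono : ∀ {a b : ℕ}, a < b →
      offset (kid leaf c) a + (kid leaf c a).numLeaves ≤ offset (kid leaf c) b :=
    fun hab => by rw [← offset_add_one]; exact offset_mono hab
  have hio := hmono hij
  -- an exit from the segment in each block whose trip leaves the segment
  have hexit : ∀ e, i ≤ e → e ≤ j → ((e + h) % (m + 1) < i ∨ j < (e + h) % (m + 1)) →
      ∃ z < (kid leaf c e).numLeaves, offset (kid leaf c) e + z ≤ offset (kid leaf c) j + r ∧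
        ((node h m c).trip (offset (kid leaf c) e + z) < offset (kid leaf c) i ∨
          offset (kid leaf c) j + r < (node h m c).trip (offset (kid leaf c) e + z)) := by
    intro e hie hej he'
    have hent : entry (kid leaf c) ((e + h) % (m + 1)) < offset (kid leaf c) i ∨
        offset (kid leaf c) j + r < entry (kid leaf c) ((e + h) % (m + 1)) := by
      have hb := hP.entry_bounds ((e + h) % (m + 1))
      rcases he' with he' | he'
      · have := hmono he'
        rw [offset_add_one] at hb
        omega
      · have := hmono he'
        omega
    rcases hej.lt_or_eq with hlt | rfl
    · obtain ⟨z, hz, -, hz'⟩ := hP.exists_trip_eq_entry (e := e) (by omega)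
      have := hmono hlt
      exact ⟨z, hz, by omega, by rwa [hz']⟩
    · obtain ⟨x', hx1, hxr, hx'⟩ := (hP.kids (a := leaf) trivial e).exists_exit_prefix
        (p := r + 1) (by omega) hr
      obtain ⟨z, rfl⟩ : ∃ z, x' = z + 1 := ⟨x' - 1, by omega⟩
      refine ⟨z, by omega, by omega, ?_⟩
      rcases hx' with hx' | hx'
      · rwa [trip_node_of_eq_zero (by omega) (by omega) hx']
      · rw [trip_node_of_ne_zero (by omega) (by omega) (by omega)]
        omega
  have htwo : ∀ e₁ e₂, i ≤ e₁ → e₁ < e₂ → e₂ ≤ j →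
      (∃ z < (kid leaf c e₁).numLeaves,
        ((node h m c).trip (offset (kid leaf c) e₁ + z) < offset (kid leaf c) i ∨
          offset (kid leaf c) j + r < (node h m c).trip (offset (kid leaf c) e₁ + z))) →
      (∃ z < (kid leaf c e₂).numLeaves, offset (kid leaf c) e₂ + z ≤ offset (kid leaf c) j + r ∧
        ((node h m c).trip (offset (kid leaf c) e₂ + z) < offset (kid leaf c) i ∨
          offset (kid leaf c) j + r < (node h m c).trip (offset (kid leaf c) e₂ + z))) →
      ∃ x y, x ≠ y ∧
        (offset (kid leaf c) i ≤ x ∧ x ≤ offset (kid leaf c) j + r) ∧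
        (offset (kid leaf c) i ≤ y ∧ y ≤ offset (kid leaf c) j + r) ∧
        ((node h m c).trip x < offset (kid leaf c) i ∨
          offset (kid leaf c) j + r < (node h m c).trip x) ∧
        ((node h m c).trip y < offset (kid leaf c) i ∨
          offset (kid leaf c) j + r < (node h m c).trip y) := by
    rintro e₁ e₂ h1 h2 h3 ⟨z₁, hz₁, hw₁⟩ ⟨z₂, hz₂, hz₂', hw₂⟩
    have a1 := hmono h2
    have a2 := offset_mono (c := c) h1
    exact ⟨_, _, by omega, ⟨by omega, by omega⟩, ⟨by omega, hz₂'⟩, hw₁, hw₂⟩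
  -- At a generic vertex, if the segment misses another edge besides the root edge, the rotation
  -- alone provides two exits.
  by_cases hlen : j + 2 ≤ i + m ∧ 2 ≤ h ∧ h + 1 ≤ m
  · obtain ⟨e₁, e₂, h1, h2, h3, h4, h5⟩ :=
      exists_two_add_mod_notMem hlen.2.1 hlen.2.2 hi hij hj hlen.1
    obtain ⟨z, hz, -, hz'⟩ := hexit e₁ h1 (by omega) h4
    exact htwo e₁ e₂ h1 h2 h3 ⟨z, hz, hz'⟩ (hexit e₂ (by omega) h3 h5)
  obtain ⟨hm2, h1, hhm, hcol, hcN⟩ := id hT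
  -- Otherwise the segment meets all children: a white or black vertex has only two of them. The
  -- last block must then be incomplete, since the segment does not contain all leaves.
  obtain ⟨rfl, rfl⟩ : i = 1 ∧ j = m := by
    by_cases hh : 2 ≤ h ∧ h + 1 ≤ m
    · omega
    · have := hcol (if h = 1 then 1 else 2) (by unfold IsColour; split_ifs <;> omega)
      omega
  have hrlt : r + 1 < (kid leaf c j).numLeaves := by
    have := hall rfl
    rw [offset_add_one] at hn
    omega
  have hPj := hP.kids (a := leaf) trivial j
  rw [hone] at *
  -- exits from the segment inside the last block
  have hlast : ∀ x', 1 ≤ x' → x' ≤ r + 1 → r + 1 < (kid leaf c j).trip x' →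
      ∃ z < (kid leaf c j).numLeaves, offset (kid leaf c) j + z ≤ offset (kid leaf c) j + r ∧
        ((node h j c).trip (offset (kid leaf c) j + z) < 1 ∨
          offset (kid leaf c) j + r < (node h j c).trip (offset (kid leaf c) j + z)) := by
    intro x' hx1 hx2 hx3
    obtain ⟨z, rfl⟩ : ∃ z, x' = z + 1 := ⟨x' - 1, by omega⟩
    refine ⟨z, by omega, by omega, Or.inr ?_⟩
    rw [trip_node_of_ne_zero (by omega) (by omega) (by omega)]
    omega
  by_cases hgen : 2 ≤ h ∧ h + 1 ≤ j
  -- The block `j + 1 - h` is rotated to the root edge, which gives the first exit. The block `j -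
  -- h` is rotated to the last block `j`: if the trip ends there beyond the segment, it is the
  -- second.
  · obtain ⟨z₁, hz₁, hz₁', hw₁⟩ := hexit (j + 1 - h) (by omega) (by omega)
      (Or.inl (by rw [show j + 1 - h + h = j + 1 by omega, Nat.mod_self]; omega))
    by_cases hent : r + 1 < (kid leaf c j).trip 0
    · obtain ⟨z₂, hz₂, -, hw₂⟩ := hP.exists_trip_eq_entry (e := j - h) (by omega)
      rw [show j - h + h = j by omega, Nat.mod_eq_of_lt (by omega), entry] at hw₂
      exact htwo (j - h) (j + 1 - h) (by omega) (by omega) (by omega)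
        ⟨z₂, hz₂, Or.inr (by omega)⟩ ⟨z₁, hz₁, hz₁', hw₁⟩
    -- The trip from the root of the last child ends inside the segment, so some other trip must
    -- leave the root together with the first `r + 1` leaves, and it starts at one of these leaves.
    · obtain ⟨x', hx', hx''⟩ := hPj.exists_exit_root_prefix hrlt
      have hx0 : x' ≠ 0 := by rintro rfl; omega
      exact htwo (j + 1 - h) j (by omega) (by omega) le_rfl ⟨z₁, hz₁, hw₁⟩
        (hlast x' (by omega) hx' hx'')
  -- the last child of a white or black vertex
  have hchild : ∀ k, IsColour k h j → j = 2 ∧ ∃ h' m' c', kid leaf c j = node h' m' c' ∧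
      (node h' m' c').IsNormal ∧ ¬ IsColour k h' m' ∧
      (r + 1 < offset (kid leaf c') 2 ∨ ∃ x y, x ≠ y ∧ (1 ≤ x ∧ x ≤ r + 1) ∧ (1 ≤ y ∧ y ≤ r + 1) ∧
        ((kid leaf c j).trip x < 1 ∨ r + 1 < (kid leaf c j).trip x) ∧
        ((kid leaf c j).trip y < 1 ∨ r + 1 < (kid leaf c j).trip y)) := by
    intro k hk
    obtain ⟨rfl, hncol⟩ := hcol k hk
    refine ⟨rfl, ?_⟩
    have hkid : kid leaf c 2 = c 1 := kid_succ leaf c (by omega)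
    have hnc := hncol 1 rfl
    rw [hkid] at hrlt ⊢
    rcases hc1 : c 1 with _ | ⟨h', m', c'⟩
    · rw [hc1, numLeaves_leaf] at hrlt
      omega
    · rw [hc1] at hrlt hnc
      have hN : (node h' m' c').IsNormal := hc1 ▸ hcN 1
      refine ⟨h', m', c', rfl, hN, hnc, ?_⟩
      have hn' := numLeaves_node h' m' c'
      obtain ⟨j', hj', r', hr', hrr⟩ :=
        exists_offset (t := kid leaf c') (d := m' + 1) (x := r + 1) (by omega)
      by_cases hj2 : 1 < j'
      · right
        have := ih 1 le_rfl hj2 (by omega) hr' (fun _ => by omega) hc1.symm (hcN 1)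
        rwa [offset_one, ← hrr, hc1] at this
      · left
        have := offset_mono (c := c') (show j' + 1 ≤ 2 by omega)
        rw [offset_add_one] at this
        omega
  -- At a white vertex the first child exits into the second one, and the second child exits to the
  -- root.
  by_cases hw : h = 1
  · subst hw
    obtain ⟨rfl, h', m', c', hkid, hN, hncol, hex⟩ := hchild 1 (Or.inl ⟨rfl, rfl⟩)
    by_cases hent : r + 1 < (kid leaf c 2).trip 0
    · obtain ⟨z₁, hz₁, -, hw₁⟩ := hP.exists_trip_eq_entry (e := 1) (by omega)
      have hw₁' : (node 1 2 c).trip (offset (kid leaf c) 1 + z₁) = entry (kid leaf c) 2 := hw₁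
      rw [entry] at hw₁'
      exact htwo 1 2 le_rfl (by omega) le_rfl ⟨z₁, hz₁, Or.inr (by omega)⟩
        (hexit 2 (by omega) le_rfl (Or.inl (by norm_num)))
    · rcases hex with hex | ⟨x, y, hxy, hx, hy, hwx, hwy⟩
      -- The segment stops within the first child of the second child, yet the trip from the root of
      -- the second child ends in it. This forces `h' = 1`, so that child is white, against
      -- normality.
      · exfalso
        have hb := hN.isProper.entry_bounds h'
        rw [hkid, trip_node_zero hN.2.2.1] at hent
        rw [entry] at hb
        have h1' : h' < 2 := by
          by_contra hge
          have := offset_mono (c := c') (show 2 ≤ h' by omega)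
          omega
        exact hncol (Or.inl ⟨rfl, by have := hN.2.1; omega⟩)
      · have key : ∀ x, 1 ≤ x → x ≤ r + 1 →
            ((kid leaf c 2).trip x < 1 ∨ r + 1 < (kid leaf c 2).trip x) →
            ((node 1 2 c).trip (offset (kid leaf c) 2 + (x - 1)) < 1 ∨
              offset (kid leaf c) 2 + r < (node 1 2 c).trip (offset (kid leaf c) 2 + (x - 1))) := by
          intro x hx1 hx2 hx3
          obtain ⟨z, rfl⟩ : ∃ z, x = z + 1 := ⟨x - 1, by omega⟩
          rcases hx3 with hx3 | hx3
          · rw [Nat.add_sub_cancel, trip_node_of_eq_zero (by omega) (by omega) (by omega)]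
            exact Or.inl Nat.one_pos
          · rw [Nat.add_sub_cancel, trip_node_of_ne_zero (by omega) (by omega) (by omega)]
            omega
        exact ⟨_, _, by omega, ⟨by omega, by omega⟩, ⟨by omega, by omega⟩, key x hx.1 hx.2 hwx,
          key y hy.1 hy.2 hwy⟩
  · obtain rfl : h = j := by omega
    -- At a black vertex the first child exits to the root, while the second exits into the first
    -- and stays in the segment. The second exit must thus be a trip inside the second child that
    -- does not end at its root.
    obtain ⟨rfl, h', m', c', hkid, hN, hncol, hex⟩ := hchild 2 (Or.inr ⟨rfl, rfl⟩)
    obtain ⟨z₁, hz₁, hz₁', hw₁⟩ := hexit 1 le_rfl (by omega) (Or.inl (by norm_num))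
    obtain ⟨x', hx1, hx2, hx3⟩ : ∃ x', 1 ≤ x' ∧ x' ≤ r + 1 ∧ r + 1 < (kid leaf c 2).trip x' := by
      rcases hex with hex | ⟨x, y, hxy, hx, hy, hwx, hwy⟩
      · obtain ⟨x', hx1, hxr, hx'⟩ := hPj.exists_exit_prefix (p := r + 1) (by omega) hr
        refine ⟨x', hx1, hxr, hx'.resolve_left fun hx0 => ?_⟩
        have hone' := offset_one (c := c')
        rw [hkid, show x' = offset (kid leaf c') 1 + (x' - 1) by omega] at hx0
        have hm' := hN.1
        have hsz : x' - 1 < (kid leaf c' 1).numLeaves := by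
          rw [offset_add_one 1] at hex
          omega
        by_cases hv : (kid leaf c' 1).trip (x' - 1 + 1) = 0
        · rw [trip_node_of_eq_zero (by omega) hsz hv] at hx0
          have hb := (hN.isProper.entry_bounds ((1 + h') % (m' + 1))).1
          -- If the exit of the first grandchild went to the root of the second child, then `h' =
          -- m'`, so that child would be black, against normality.
          have hmod : (1 + h') % (m' + 1) = 0 := by
            by_contra hne
            have := offset_mono (c := c') (show 1 ≤ (1 + h') % (m' + 1) by omega)
            omega
          rw [add_mod_eq (by omega) (by have := hN.2.2.1; omega)] at hmod
          have h3 := hN.2.2.1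
          exact hncol (Or.inr ⟨rfl, by split_ifs at hmod <;> omega⟩)
        · rw [trip_node_of_ne_zero (by omega) hsz hv] at hx0
          omega
      · by_cases hx0 : (kid leaf c 2).trip x < 1
        · have hy0 : ¬ (kid leaf c 2).trip y < 1 := fun hy0 => by
            exact hxy (hPj.isDerangement.inj x (by omega) y (by omega) (by omega))
          exact ⟨y, hy.1, hy.2, hwy.resolve_left hy0⟩
        · exact ⟨x, hx.1, hx.2, hwx.resolve_left hx0⟩
    exact htwo 1 2 le_rfl (by omega) le_rfl ⟨z₁, hz₁, hw₁⟩ (hlast x' hx1 hx2 hx3)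

end PlaneTree

end GrassmannianTree
-- Uniqueness of the normal form
namespace GrassmannianTree

open Finset

namespace PlaneTree

theorem IsProper.offset_lt {h m : ℕ} {c : Fin m → PlaneTree} (hT : (node h m c).IsProper)
    {a b : ℕ} (hab : a < b) : offset (kid leaf c) a < offset (kid leaf c) b := by
  have h1 := (hT.kids (a := leaf) trivial a).one_le_numLeaves
  have h2 := offset_mono (c := c) hab
  rw [Nat.succ_eq_add_one, offset_add_one] at h2
  omega

section unique

variable {h m h' m' : ℕ} {c : Fin m → PlaneTree} {c' : Fin m' → PlaneTree}

/-- If the `i`-th block of the second tree were longer, it would be a segment with two exits for the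
first tree, but it has only one exit as a block. By symmetry the blocks of two normal trees with
equal trips coincide. -/
theorem offset_le_of_trip_eq (hT : (node h m c).IsNormal) (hT' : (node h' m' c').IsProper)
    (hn : (node h m c).numLeaves = (node h' m' c').numLeaves)
    (htrip : ∀ x ≤ (node h m c).numLeaves, (node h m c).trip x = (node h' m' c').trip x)
    {i : ℕ} (hi : 1 ≤ i) (him : i ≤ m) (him' : i ≤ m')
    (ho : offset (kid leaf c) i = offset (kid leaf c') i) :
    offset (kid leaf c') (i + 1) ≤ offset (kid leaf c) (i + 1) := by
  by_contra! hlt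
  have e1 := numLeaves_node h m c
  have e2 := numLeaves_node h' m' c'
  have hle := offset_mono (c := c') (show i + 1 ≤ m' + 1 by omega)
  obtain ⟨j, hj, r, hr, hjr⟩ := exists_offset (t := kid leaf c) (d := m + 1)
    (x := offset (kid leaf c') (i + 1) - 1) (by omega)
  have hij : i < j := by
    by_contra hij
    have := offset_mono (c := c) (show j + 1 ≤ i + 1 by omega)
    rw [offset_add_one j] at this
    omega
  obtain ⟨x, y, hxy, hx, hy, hwx, hwy⟩ := hT.exists_two_exits hi hij (by omega) hr (by
    rintro rfl heq
    have := hT'.offset_lt (show 1 + 1 < m' + 1 by have := hT'.1; omega)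
    omega)
  rw [htrip x (by omega)] at hwx
  rw [htrip y (by omega)] at hwy
  exact hxy (hT'.exit_unique (e := i) (by omega) (by omega) (by omega) (by omega) (by omega)
    (by omega) (by omega))

/-- At a leaf of the block, the child's trip is visible unless it leaves the block, and then it ends
at `0`. The value at `0` is the only one left over. -/
theorem kid_trip_eq {e : ℕ} (hT : (node h m c).IsProper) (hT' : (node h' m' c').IsProper)
    (htrip : ∀ x ≤ (node h m c).numLeaves, (node h m c).trip x = (node h' m' c').trip x)
    (he : e < m + 1) (he' : e < m' + 1)
    (ho : offset (kid leaf c) e = offset (kid leaf c') e)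
    (hn : (kid leaf c e).numLeaves = (kid leaf c' e).numLeaves) :
    ∀ x ≤ (kid leaf c e).numLeaves, (kid leaf c e).trip x = (kid leaf c' e).trip x := by
  have hd := (hT.kids (a := leaf) trivial e).isDerangement
  have hd' := (hT'.kids (a := leaf) trivial e).isDerangement
  have e1 := numLeaves_node h m c
  have hle := offset_mono (c := c) (show e + 1 ≤ m + 1 by omega)
  have ho1 := offset_add_one (c := c) e
  have ho1' := offset_add_one (c := c') e
  have out : ∀ {h m : ℕ} {c : Fin m → PlaneTree}, (node h m c).IsProper → e < m + 1 →
      entry (kid leaf c) ((e + h) % (m + 1)) < offset (kid leaf c) e ∨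
        offset (kid leaf c) (e + 1) ≤ entry (kid leaf c) ((e + h) % (m + 1)) := by
    intro h m c hT he
    have hne := add_mod_ne_self he hT.2.1 (Nat.lt_succ_of_le hT.2.2.1)
    have hb := hT.entry_bounds ((e + h) % (m + 1))
    rcases lt_or_gt_of_ne hne with hlt | hgt
    · have := offset_mono (c := c) (show (e + h) % (m + 1) + 1 ≤ e from hlt)
      omega
    · have := offset_mono (c := c) (show e + 1 ≤ (e + h) % (m + 1) from hgt)
      omega
  have key : ∀ z < (kid leaf c e).numLeaves,
      (kid leaf c e).trip (z + 1) = (kid leaf c' e).trip (z + 1) := by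
    intro z hz
    have ht := htrip (offset (kid leaf c) e + z) (by omega)
    have o1 := out hT he
    have o2 := out hT' he'
    have l1 := hd.le (z + 1) hz
    have l2 := hd'.le (z + 1) (by omega)
    by_cases hv : (kid leaf c e).trip (z + 1) = 0 <;>
      by_cases hv' : (kid leaf c' e).trip (z + 1) = 0
    · omega
    · rw [trip_node_of_eq_zero he hz hv, ho, trip_node_of_ne_zero he' (by omega) hv'] at ht
      omega
    · rw [trip_node_of_ne_zero he hz hv, ho, trip_node_of_eq_zero he' (by omega) hv'] at ht
      omega
    · rw [trip_node_of_ne_zero he hz hv, ho, trip_node_of_ne_zero he' (by omega) hv'] at ht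
      omega
  intro x hx
  rcases x with _ | z
  · obtain ⟨u, hu, hue⟩ := hd'.surj (y := (kid leaf c e).trip 0) (by
      rw [← hn]; exact hd.le 0 (Nat.zero_le _))
    rcases u with _ | z
    · exact hue.symm
    · rw [← key z (by omega)] at hue
      exact absurd (hd.inj _ (by omega) 0 (Nat.zero_le _) hue) (by omega)
  · exact key z hx

end unique

/-- A normal tree is determined by its trips. -/
theorem IsNormal.eq_of_trip_eq {S T : PlaneTree} (hS : S.IsNormal) (hT : T.IsNormal)
    (hn : S.numLeaves = T.numLeaves) (htrip : ∀ x ≤ S.numLeaves, S.trip x = T.trip x) :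
    S = T := by
  have two_le : ∀ {h m : ℕ} {c : Fin m → PlaneTree}, (node h m c).IsProper →
      2 ≤ (node h m c).numLeaves := by
    intro h m c hT
    have h1 := numLeaves_node h m c
    have h2 := hT.offset_lt (show 1 < 2 by omega)
    have h3 := hT.offset_lt (show 2 < m + 1 by have := hT.1; omega)
    rw [offset_one] at h2
    omega
  induction S generalizing T with
  | leaf =>
    rcases T with _ | ⟨h', m', c'⟩
    · rfl
    · have := two_le hT.isProper
      rw [numLeaves_leaf] at hn
      omega
  | node h m c ih =>
    rcases T with _ | ⟨h', m', c'⟩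
    · have := two_le hS.isProper
      rw [numLeaves_leaf] at hn
      omega
    have hP := hS.isProper
    have hP' := hT.isProper
    have e1 := numLeaves_node h m c
    have e2 := numLeaves_node h' m' c'
    have ho : ∀ i, 1 ≤ i → i ≤ m + 1 → i ≤ m' + 1 →
        offset (kid leaf c) i = offset (kid leaf c') i := by
      intro i hi
      induction i, hi using Nat.le_induction with
      | base => intro _ _; rw [offset_one, offset_one]
      | succ i hi ihi =>
        intro him him'
        have hoi := ihi (by omega) (by omega)
        exact le_antisymm
          (offset_le_of_trip_eq hT hP hn.symm (fun x hx => (htrip x (by omega)).symm) hi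
            (by omega) (by omega) hoi.symm)
          (offset_le_of_trip_eq hS hP' hn htrip hi (by omega) (by omega) hoi)
    obtain rfl : m = m' := by
      rcases lt_trichotomy m m' with hlt | heq | hlt
      · have := ho (m + 1) (by omega) (by omega) (by omega)
        have := hP'.offset_lt (show m + 1 < m' + 1 by omega)
        omega
      · exact heq
      · have := ho (m' + 1) (by omega) (by omega) (by omega)
        have := hP.offset_lt (show m' + 1 < m + 1 by omega)
        omega
    have hc : c = c' := by
      funext i
      have hk : (kid leaf c (i + 1)).numLeaves = (kid leaf c' (i + 1)).numLeaves := by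
        have h1 := ho (i + 1) (by omega) (by omega) (by omega)
        have h2 := ho (i + 1 + 1) (by omega) (by omega) (by omega)
        rw [offset_add_one (c := c) (i + 1), offset_add_one (c := c') (i + 1)] at h2
        omega
      have ht := kid_trip_eq hP hP' htrip (e := i + 1) (by omega) (by omega)
        (ho _ (by omega) (by omega) (by omega)) hk
      rw [kid_succ _ _ i.isLt, kid_succ _ _ i.isLt] at hk ht
      exact ih i (hS.2.2.2.2 i) (hT.2.2.2.2 i) hk ht
    subst hc
    -- The trip from the root ends in block number `h`, which recovers the helicity.
    have h0 := htrip 0 (Nat.zero_le _)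
    rw [trip_node_zero hP.2.2.1, trip_node_zero hP'.2.2.1] at h0
    have b1 := hP.entry_bounds h
    have b2 := hP.entry_bounds h'
    simp only [entry] at b1 b2
    rcases lt_trichotomy h h' with hlt | rfl | hlt
    · have := offset_mono (c := c) (show h + 1 ≤ h' from hlt)
      omega
    · rfl
    · have := offset_mono (c := c) (show h' + 1 ≤ h from hlt)
      omega

end PlaneTree

end GrassmannianTree
-- From normal trees to decorated permutations
namespace GrassmannianTree

open Finset

open PlaneTree

namespace PlaneTree

/-- The separate clause for `n ≤ 2` only concerns the single edge here, and there both formulas give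
`1`. -/
theorem IsProper.momDim {T : PlaneTree} (hT : T.IsProper) : T.momDim = 1 + T.sumVertexDim := by
  have h1 := hT.one_le_numLeaves
  rw [PlaneTree.momDim, numBoundary, length_leaves]
  split_ifs with h2
  · rcases T with _ | ⟨h, m, c⟩
    · rfl
    · have h3 := numLeaves_node h m c
      have h4 := hT.offset_lt (show 1 < 2 by omega)
      have h5 := hT.offset_lt (show 2 < m + 1 by have := hT.1; omega)
      rw [offset_one] at h4
      omega
  · rfl

end PlaneTree

/-- The trips of `w` are those of the tree `T`, and `w` has no fixed points. -/
def HasTrips {n : ℕ} (w : DecoratedPerm n) (T : PlaneTree) : Prop :=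
  T.numLeaves + 1 = n ∧ (∀ i : Fin n, (w.perm i : ℕ) = T.trip i) ∧ w.white = ∅

theorem HasTrips.ext {n : ℕ} {v w : DecoratedPerm n} {T : PlaneTree} (hv : HasTrips v T)
    (hw : HasTrips w T) : v = w :=
  DecoratedPerm.ext (Equiv.ext fun i => Fin.ext ((hv.2.1 i).trans (hw.2.1 i).symm))
    (hv.2.2.trans hw.2.2.symm)

theorem HasTrips.eq {n : ℕ} {w : DecoratedPerm n} {S T : PlaneTree} (hS : S.IsNormal)
    (hT : T.IsNormal) (hwS : HasTrips w S) (hwT : HasTrips w T) : S = T := by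
  have h1 := hwS.1
  have h2 := hwT.1
  exact hS.eq_of_trip_eq hT (by omega) fun x hx =>
    (hwS.2.1 ⟨x, by omega⟩).symm.trans (hwT.2.1 ⟨x, by omega⟩)

theorem HasTrips.of_equivalent {n : ℕ} {w : DecoratedPerm n} {S T : PlaneTree}
    (h : Equivalent S T) (hw : HasTrips w S) : HasTrips w T := by
  have h1 := hw.1
  exact ⟨h.1 ▸ hw.1, fun i => (hw.2.1 i).trans (h.2 i (by omega)), hw.2.2⟩

theorem exists_hasTrips {T : PlaneTree} (hT : T.IsProper) {n : ℕ} (hn : T.numLeaves + 1 = n) :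
    ∃ w : DecoratedPerm n, HasTrips w T := by
  subst hn
  have hlt : ∀ i : Fin (T.numLeaves + 1), T.trip i < T.numLeaves + 1 := fun i =>
    Nat.lt_succ_of_le (hT.isDerangement.le _ (Nat.lt_succ_iff.1 i.isLt))
  have hinj : Function.Injective fun i : Fin (T.numLeaves + 1) =>
      (⟨T.trip i, hlt i⟩ : Fin (T.numLeaves + 1)) := fun i j hij => Fin.ext
    (hT.isDerangement.inj _ (Nat.lt_succ_iff.1 i.isLt) _ (Nat.lt_succ_iff.1 j.isLt)
      (congrArg Fin.val hij))
  exact ⟨⟨Equiv.ofBijective _ (Finite.injective_iff_bijective.1 hinj), ∅, by simp⟩,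
    rfl, fun i => rfl, rfl⟩

theorem white_eq_empty {n : ℕ} {w : DecoratedPerm n} (hw : ∀ i, w.perm i ≠ i) : w.white = ∅ :=
  Finset.eq_empty_iff_forall_notMem.2 fun i hi => hw i (w.white_fixed i hi)

theorem exists_normal_hasTrips {n : ℕ} (hn : n ≠ 1) {w : DecoratedPerm n}
    (hw : IsGrassmannianTreePerm w) : ∃ T : PlaneTree, T.IsNormal ∧ HasTrips w T := by
  have hne : ∀ {T : PlaneTree}, T.IsProper → T.numLeaves + 1 = n →
      (∀ i : Fin n, (w.perm i : ℕ) = T.trip i) → HasTrips w T := fun {T} hT hTn hwT =>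
    ⟨hTn, hwT, white_eq_empty fun i hi => hT.isDerangement.ne i (by omega) (by
      rw [← hwT, hi])⟩
  cases hw with
  | one => exact absurd rfl hn
  | two w hw =>
    refine ⟨leaf, trivial, hne trivial rfl fun i => ?_⟩
    rw [hw]
    fin_cases i <;> rfl
  | built w hw =>
    obtain ⟨-, T, hT, hTn, hTt⟩ := hw.isTripMap
    obtain ⟨S, hS, hTS⟩ := hT.exists_isNormal
    exact ⟨S, hS, (hne hT hTn hTt).of_equivalent hTS⟩

theorem HasTrips.isGrassmannianTreePerm {n : ℕ} {w : DecoratedPerm n} {T : PlaneTree}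
    (hT : T.IsProper) (hw : HasTrips w T) : IsGrassmannianTreePerm w := by
  obtain ⟨rfl, ht, -⟩ := hw
  rcases hT.isLeafOrBuilt with rfl | hb
  · refine IsGrassmannianTreePerm.two w (Equiv.ext fun i => Fin.ext ((ht i).trans ?_))
    fin_cases i <;> rfl
  · exact IsGrassmannianTreePerm.built w (hb _ ht)

theorem HasTrips.hasMomDim_iff {n r : ℕ} {w : DecoratedPerm n} {T : PlaneTree}
    (hT : T.IsNormal) (hw : HasTrips w T) : HasMomDim w r ↔ T.sumVertexDim + 1 = r := by
  have hn := hT.isProper.one_le_numLeaves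
  constructor
  · rintro ⟨S, hS | hS, hSw, rfl⟩
    · obtain ⟨h, c, -, rfl⟩ := hS
      have h1 := hSw.1
      have h2 := hw.1
      rw [numBoundary, length_leaves] at h1
      simp only [numLeaves, univ_eq_empty, sum_empty] at h1
      omega
    · obtain ⟨S', hS', hSS'⟩ := hS.exists_isNormal
      have := HasTrips.of_equivalent hSS' ((hS.isTripPerm_iff w).1 hSw)
      rw [hS.momDim, hSS'.3, HasTrips.eq hS' hT this hw, add_comm]
  · rintro rfl
    exact ⟨T, Or.inr hT.isProper, (hT.isProper.isTripPerm_iff w).2 hw, by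
      rw [hT.isProper.momDim, add_comm]⟩

theorem HasTrips.card_antiexcedances {n : ℕ} {w : DecoratedPerm n} {T : PlaneTree}
    (hT : T.IsProper) (hw : HasTrips w T) : w.antiexcedances.card = T.sumHelicity + 1 := by
  obtain ⟨rfl, ht, hwh⟩ := hw
  rw [← hT.numDescents_trip, numDescents, Finset.sum_range, DecoratedPerm.antiexcedances,
    Finset.card_filter]
  -- Substituting `w x` for the letter turns the condition `i < w⁻¹ i` into the descent `w x < x`.
  refine (Equiv.sum_comp w.perm _).symm.trans (sum_congr rfl fun i _ => ?_)
  rw [← ht]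
  simp [hwh]

theorem hasMomDim_one_iff {w : DecoratedPerm 1} {r : ℕ} : HasMomDim w r ↔ r = 0 := by
  constructor
  · rintro ⟨T, -, hw, rfl⟩
    rw [momDim, hw.1]
    rfl
  · rintro rfl
    have hwi : ∀ i, w.perm i = 0 := fun i => Subsingleton.elim _ _
    refine ⟨node (if 0 ∈ w.white then 1 else 0) 0 Fin.elim0,
      Or.inl ⟨_, _, by split_ifs <;> omega, rfl⟩, ⟨rfl, fun i => ?_, fun i => ?_⟩, rfl⟩
    · rw [hwi, Subsingleton.elim i 0]
      have := TripStep.turn (T := node (if 0 ∈ w.white then 1 else 0) 0 Fin.elim0) [] _ 0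
        Fin.elim0 0 rfl Nat.one_pos
      rw [Nat.mod_one] at this
      exact Relation.ReflTransGen.single this
    · rw [Subsingleton.elim i 0, hwi]
      split_ifs with h <;> simp [h]

theorem existsUnique_hasMomDim {n : ℕ} {w : DecoratedPerm n} (hw : IsGrassmannianTreePerm w) :
    ∃! r : ℕ, HasMomDim w r := by
  by_cases hn : n = 1
  · subst hn
    exact ⟨0, hasMomDim_one_iff.2 rfl, fun r hr => hasMomDim_one_iff.1 hr⟩
  · obtain ⟨T, hT, hTw⟩ := exists_normal_hasTrips hn hw
    exact ⟨_, (hTw.hasMomDim_iff hT).2 rfl, fun r hr => ((hTw.hasMomDim_iff hT).1 hr).symm⟩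

theorem ncard_eq_ncard_normal {n : ℕ} (hn : n ≠ 1) (k r : ℕ) :
    Set.ncard {w : DecoratedPerm n | IsGrassmannianTreePerm w ∧ w.antiexcedances.card = k ∧
      HasMomDim w r} = Set.ncard {T : PlaneTree | T.IsNormal ∧ T.numLeaves + 1 = n ∧
        T.sumHelicity + 1 = k ∧ T.sumVertexDim + 1 = r} := by
  refine Set.ncard_congr (fun w hw => (exists_normal_hasTrips hn hw.1).choose) ?_ ?_ ?_
  · intro w hw
    obtain ⟨hT, hTw⟩ := (exists_normal_hasTrips hn hw.1).choose_spec
    exact ⟨hT, hTw.1, (hTw.card_antiexcedances hT.isProper).symm.trans hw.2.1,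
      (hTw.hasMomDim_iff hT).1 hw.2.2⟩
  · intro v w hv hw hvw
    have h1 := (exists_normal_hasTrips hn hv.1).choose_spec.2
    have h2 := (exists_normal_hasTrips hn hw.1).choose_spec.2
    rw [hvw] at h1
    exact h1.ext h2
  · rintro T ⟨hT, hTn, rfl, rfl⟩
    obtain ⟨w, hw⟩ := exists_hasTrips hT.isProper hTn
    have hG := hw.isGrassmannianTreePerm hT.isProper
    refine ⟨w, ⟨hG, hw.card_antiexcedances hT.isProper, (hw.hasMomDim_iff hT).2 rfl⟩, ?_⟩
    obtain ⟨hT', hTw⟩ := (exists_normal_hasTrips hn hG).choose_spec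
    exact HasTrips.eq hT' hT hTw hw

theorem card_antiexcedances_one (w : DecoratedPerm 1) : w.antiexcedances = w.white := by
  ext i
  rw [Subsingleton.elim i 0]
  simp [DecoratedPerm.antiexcedances]

theorem ncard_one (k r : ℕ) :
    Set.ncard {w : DecoratedPerm 1 | IsGrassmannianTreePerm w ∧ w.antiexcedances.card = k ∧
      HasMomDim w r} = if r = 0 ∧ k ≤ 1 then 1 else 0 := by
  split_ifs with h
  · obtain ⟨rfl, hk⟩ := h
    rw [Set.ncard_eq_one]
    refine ⟨⟨1, if k = 1 then univ else ∅, fun i _ => rfl⟩, ?_⟩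
    ext w
    simp only [Set.mem_ofPred_eq, Set.mem_singleton_iff, card_antiexcedances_one,
      hasMomDim_one_iff, and_true, IsGrassmannianTreePerm.one, true_and]
    constructor
    · intro hw
      refine DecoratedPerm.ext (Subsingleton.elim _ _) ?_
      split_ifs with h1
      · exact Finset.card_eq_iff_eq_univ _ |>.1 (by rw [hw, h1]; rfl)
      · exact Finset.card_eq_zero.1 (by omega)
    · rintro rfl
      dsimp only
      split_ifs with h1
      · rw [h1]; rfl
      · rw [card_empty]; omega
  · rw [Set.ncard_eq_zero]
    refine Set.eq_empty_iff_forall_notMem.2 fun w hw => h ⟨hasMomDim_one_iff.1 hw.2.2, ?_⟩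
    rw [← hw.2.1]
    exact Finset.card_le_univ _

end GrassmannianTree
-- Generating functions of trees
namespace GrassmannianTree

open Finset

namespace PlaneTree

theorem IsProper.numLeaves_child_lt {h m : ℕ} {c : Fin m → PlaneTree}
    (hT : (node h m c).IsProper) (i : Fin m) : (c i).numLeaves + (m - 1) ≤ (node h m c).numLeaves := by
  rw [numLeaves, ← add_sum_erase univ _ (mem_univ i)]
  refine Nat.add_le_add_left ?_ _
  calc m - 1 = ∑ _j ∈ univ.erase i, 1 := by simp
    _ ≤ _ := sum_le_sum fun j _ => (hT.2.2.2 j).one_le_numLeaves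

/-- With at least two children, each having a leaf, every child has fewer leaves than the tree, and
the number of leaves also bounds `m` and `h`. -/
theorem finite_isProper (n : ℕ) : {T : PlaneTree | T.IsProper ∧ T.numLeaves ≤ n}.Finite := by
  induction n with
  | zero =>
    refine Set.finite_empty.subset fun T hT => ?_
    have := hT.1.one_le_numLeaves
    have := hT.2
    omega
  | succ n ih =>
    have hfin : (⋃ h ∈ Set.Iic (n + 1), ⋃ m ∈ Set.Iic (n + 1),
        node h m '' Set.univ.pi fun _ => {T : PlaneTree | T.IsProper ∧ T.numLeaves ≤ n}).Finite :=
      (Set.finite_Iic _).biUnion fun h _ => (Set.finite_Iic _).biUnion fun m _ =>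
        (Set.Finite.pi' fun _ => ih).image _ |>.subset (Set.image_mono fun c hc i => hc i trivial)
    refine ((Set.finite_singleton leaf).union hfin).subset ?_
    rintro (_ | ⟨h, m, c⟩) ⟨hT, hn⟩
    · exact Or.inl rfl
    · right
      have hm := hT.1
      have hlt := fun i => hT.numLeaves_child_lt i
      have h0 := hlt ⟨0, by omega⟩
      have h1 := (hT.2.2.2 ⟨0, by omega⟩).one_le_numLeaves
      have hh := hT.2.2.1
      simp only [Set.mem_iUnion, Set.mem_Iic, Set.mem_image]
      exact ⟨h, by omega, m, by omega, c, fun i _ => ⟨hT.2.2.2 i, by have := hlt i; omega⟩, rfl⟩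

open Classical in
/-- The proper trees in `A` with `n` leaves. -/
noncomputable def level (A : Set PlaneTree) (n : ℕ) : Finset PlaneTree :=
  (finite_isProper n).toFinset.filter fun T => T.numLeaves = n ∧ T ∈ A

theorem mem_level {A : Set PlaneTree} {n : ℕ} {T : PlaneTree} :
    T ∈ level A n ↔ T.IsProper ∧ T.numLeaves = n ∧ T ∈ A := by
  simp only [level, mem_filter, Set.Finite.mem_toFinset, Set.mem_ofPred_eq]
  constructor
  · rintro ⟨⟨h1, -⟩, h2⟩
    exact ⟨h1, h2⟩
  · rintro ⟨h1, h2⟩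
    exact ⟨⟨h1, h2.1.le⟩, h2⟩

/-- The monomial `y^a q^b`. -/
noncomputable def monomialYQ (a b : ℕ) : Polynomial (Polynomial ℤ) :=
  Polynomial.C (Polynomial.X ^ a) * Polynomial.X ^ b

theorem monomialYQ_mul (a b a' b' : ℕ) :
    monomialYQ a b * monomialYQ a' b' = monomialYQ (a + a') (b + b') := by
  simp only [monomialYQ, pow_add, map_mul]
  ring

theorem C_monomialYQ (a b : ℕ) : (PowerSeries.C (monomialYQ a b) : GF) = y ^ a * q ^ b := by
  simp [monomialYQ, y, q]

theorem coeff_coeff_monomialYQ (a b k r : ℕ) :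
    ((monomialYQ a b).coeff r).coeff k = if a = k ∧ b = r then 1 else 0 := by
  rw [monomialYQ, Polynomial.coeff_C_mul, Polynomial.coeff_X_pow]
  by_cases h1 : b = r
  · subst h1
    simp [Polynomial.coeff_X_pow, eq_comm]
  · simp [h1, Ne.symm h1]

/-- The weight of a tree in the generating functions. -/
noncomputable def weight (T : PlaneTree) : Polynomial (Polynomial ℤ) :=
  monomialYQ T.sumHelicity T.sumVertexDim

/-- The generating function of the proper trees in `A`. -/
noncomputable def treeSeries (A : Set PlaneTree) : GF :=
  PowerSeries.mk fun n => ∑ T ∈ level A n, weight T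

theorem treeSeries_union {A B C : Set PlaneTree}
    (hC : ∀ T : PlaneTree, T.IsProper → (T ∈ C ↔ T ∈ A ∨ T ∈ B))
    (hAB : ∀ T ∈ A, T ∉ B) : treeSeries C = treeSeries A + treeSeries B := by
  classical
  ext1 n
  simp only [treeSeries, map_add, PowerSeries.coeff_mk]
  rw [← sum_union]
  · refine sum_congr ?_ fun _ _ => rfl
    ext T
    simp only [mem_union, mem_level]
    constructor
    · rintro ⟨h1, h2, h3⟩
      exact ((hC T h1).1 h3).imp (fun h => ⟨h1, h2, h⟩) fun h => ⟨h1, h2, h⟩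
    · rintro (⟨h1, h2, h3⟩ | ⟨h1, h2, h3⟩)
      · exact ⟨h1, h2, (hC T h1).2 (Or.inl h3)⟩
      · exact ⟨h1, h2, (hC T h1).2 (Or.inr h3)⟩
  · rw [disjoint_left]
    intro T hA hB
    exact hAB T (mem_level.1 hA).2.2 (mem_level.1 hB).2.2

/-- The generating function of the trees that are obtained by composing two trees. -/
theorem treeSeries_image2 {A B C : Set PlaneTree} (f : PlaneTree → PlaneTree → PlaneTree)
    (i j : ℕ)
    (hf : ∀ S ∈ A, ∀ T ∈ B, S.IsProper → T.IsProper → f S T ∈ C ∧ (f S T).IsProper ∧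
      (f S T).numLeaves = S.numLeaves + T.numLeaves ∧
      (f S T).sumHelicity = i + (S.sumHelicity + T.sumHelicity) ∧
      (f S T).sumVertexDim = j + (S.sumVertexDim + T.sumVertexDim))
    (hinj : ∀ S ∈ A, ∀ T ∈ B, ∀ S' ∈ A, ∀ T' ∈ B, f S T = f S' T' → S = S' ∧ T = T')
    (hsurj : ∀ U ∈ C, U.IsProper → ∃ S ∈ A, ∃ T ∈ B, S.IsProper ∧ T.IsProper ∧ f S T = U) :
    treeSeries C = y ^ i * q ^ j * (treeSeries A * treeSeries B) := by
  ext1 n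
  rw [← C_monomialYQ, PowerSeries.coeff_C_mul, PowerSeries.coeff_mul]
  simp only [treeSeries, PowerSeries.coeff_mk]
  simp_rw [sum_mul_sum, ← sum_product', mul_sum]
  rw [sum_sigma']
  symm
  refine sum_nbij (fun p => f p.2.1 p.2.2) ?_ ?_ ?_ ?_
  · rintro ⟨⟨a, b⟩, S, T⟩ h
    simp only [mem_sigma, HasAntidiagonal.mem_antidiagonal, mem_product, mem_level] at h
    obtain ⟨rfl, ⟨hS, rfl, hSA⟩, hT, rfl, hTB⟩ := h
    obtain ⟨h1, h2, h3, -⟩ := hf S hSA T hTB hS hT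
    exact mem_level.2 ⟨h2, h3, h1⟩
  · rintro ⟨⟨a, b⟩, S, T⟩ h ⟨⟨a', b'⟩, S', T'⟩ h' heq
    simp only [coe_sigma, Set.mem_sigma_iff, mem_coe, HasAntidiagonal.mem_antidiagonal, mem_product,
      mem_level] at h h'
    obtain ⟨-, ⟨hS, rfl, hSA⟩, hT, rfl, hTB⟩ := h
    obtain ⟨-, ⟨hS', rfl, hSA'⟩, hT', rfl, hTB'⟩ := h'
    obtain ⟨rfl, rfl⟩ := hinj S hSA T hTB S' hSA' T' hTB' heq
    rfl
  · intro U hU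
    obtain ⟨hP, hn, hUC⟩ := mem_level.1 hU
    obtain ⟨S, hSA, T, hTB, hS, hT, rfl⟩ := hsurj U hUC hP
    obtain ⟨-, -, h3, -⟩ := hf S hSA T hTB hS hT
    refine ⟨⟨⟨S.numLeaves, T.numLeaves⟩, S, T⟩, ?_, rfl⟩
    simp only [coe_sigma, Set.mem_sigma_iff, mem_coe, HasAntidiagonal.mem_antidiagonal, mem_product, mem_level]
    exact ⟨by rw [← hn, h3], ⟨hS, trivial, hSA⟩, hT, trivial, hTB⟩
  · rintro ⟨⟨a, b⟩, S, T⟩ h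
    simp only [mem_sigma, HasAntidiagonal.mem_antidiagonal, mem_product, mem_level] at h
    obtain ⟨-, ⟨hS, -, hSA⟩, hT, -, hTB⟩ := h
    obtain ⟨-, -, -, h4, h5⟩ := hf S hSA T hTB hS hT
    simp only [weight, h4, h5, monomialYQ_mul]

/-! ### The generating function of the normal trees -/

/-- Normal trees with a white (`k = 1`) or black (`k = 2`) root vertex. -/
def colourSet (k : ℕ) : Set PlaneTree := {T | T.IsNormal ∧ T.HasColour k}

/-- Normal trees without a white (`k = 1`) or black (`k = 2`) root vertex. -/
def noColourSet (k : ℕ) : Set PlaneTree := {T | T.IsNormal ∧ ¬ T.HasColour k}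

/-- Trees whose root vertex has helicity `h` and degree `m + 1` with `p h m`, and with normal
subtrees below it. -/
def rootSet (p : ℕ → ℕ → Prop) : Set PlaneTree :=
  {T | ∃ h m c, T = node h m c ∧ p h m ∧ ∀ i, (c i).IsNormal}

theorem treeSeries_colourSet {k : ℕ} (hk : k = 1 ∨ k = 2) :
    treeSeries (colourSet k) = y ^ (k - 1) * q ^ 1 *
      (treeSeries {T | T.IsNormal} * treeSeries (noColourSet k)) := by
  have hkc : IsColour k k 2 := by rcases hk with rfl | rfl <;> simp [IsColour]
  refine treeSeries_image2 (bin k) (k - 1) 1 ?_ ?_ ?_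
  · rintro S hS T ⟨hT, hTk⟩ - -
    have hN := isNormal_bin.2 ⟨hk, hS, hT, hTk⟩
    refine ⟨⟨hN, hkc⟩, hN.isProper, by simp [bin, numLeaves], ?_, ?_⟩
    · simp [bin, sumHelicity]
    · simp [bin, sumVertexDim, hkc.vertexDim]
  · intro S _ T _ S' _ T' _ heq
    simp only [bin, node.injEq, heq_eq_eq, true_and] at heq
    exact ⟨congrFun heq 0, congrFun heq 1⟩
  · rintro U ⟨hU, hUk⟩ -
    obtain ⟨a, b, rfl⟩ := hU.eq_bin hUk
    obtain ⟨-, ha, hb, hbk⟩ := isNormal_bin.1 hU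
    exact ⟨a, ha, b, ⟨hb, hbk⟩, ha.isProper, hb.isProper, rfl⟩

theorem treeSeries_normal_eq_colour_add (k : ℕ) :
    treeSeries {T | T.IsNormal} = treeSeries (colourSet k) + treeSeries (noColourSet k) :=
  treeSeries_union (fun T _ => by
    by_cases h : T.HasColour k <;> simp [colourSet, noColourSet, h]) fun T h h' => h'.2 h.2

/-- Add one more child to the root vertex, and increase its helicity by `d`. -/
def addChild (d : ℕ) : PlaneTree → PlaneTree → PlaneTree
  | leaf, _ => leaf
  | node h m c, T => node (h + d) (m + 1) (Fin.snoc c T)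

theorem vertexDim_of_generic {h m : ℕ} (hh : 2 ≤ h) (hm : h ≤ m) (hm2 : h = m → m = 2) :
    vertexDim h (m + 1) = 2 * m - 2 := by
  unfold vertexDim
  split_ifs <;> omega

/-- One more edge raises `2 deg(v) - 4` by `2`. The pair `h = m = 2` is admitted too, since there
`deg(v) - 1 = 2 deg(v) - 4`; it is the seed from which all generic vertices grow. -/
theorem treeSeries_addChild (d : ℕ) {p p' : ℕ → ℕ → Prop}
    (hp : ∀ h m, p h m → 2 ≤ h ∧ h + d ≤ m ∧ (h = m → m = 2))
    (hp' : ∀ h m, p' h m ↔ ∃ h' m', h = h' + d ∧ m = m' + 1 ∧ p h' m') :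
    treeSeries (rootSet p') =
      y ^ d * q ^ 2 * (treeSeries (rootSet p) * treeSeries {T | T.IsNormal}) := by
  refine treeSeries_image2 (addChild d) d 2 ?_ ?_ ?_
  · rintro _ ⟨h, m, c, rfl, hhm, hc⟩ T hT hS hT'
    obtain ⟨h2, hd, hm2⟩ := hp h m hhm
    refine ⟨⟨_, _, _, rfl, (hp' _ _).2 ⟨h, m, rfl, rfl, hhm⟩, fun i => ?_⟩,
      ⟨by omega, by omega, by omega, fun i => ?_⟩, ?_, ?_, ?_⟩
    · refine Fin.lastCases ?_ (fun i => ?_) i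
      · rw [Fin.snoc_last]; exact hT
      · rw [Fin.snoc_castSucc]; exact hc i
    · refine Fin.lastCases ?_ (fun i => ?_) i
      · rw [Fin.snoc_last]; exact hT'
      · rw [Fin.snoc_castSucc]; exact (hc i).isProper
    · simp [addChild, numLeaves, Fin.sum_univ_castSucc]
    · simp only [addChild, sumHelicity, Fin.sum_univ_castSucc, Fin.snoc_castSucc, Fin.snoc_last]
      omega
    · simp only [addChild, sumVertexDim, Fin.sum_univ_castSucc, Fin.snoc_castSucc, Fin.snoc_last]
      rw [vertexDim_of_generic h2 (by omega) hm2,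
        vertexDim_of_generic (by omega) (by omega) (by omega)]
      omega
  · rintro _ ⟨h, m, c, rfl, -⟩ T - _ ⟨h', m', c', rfl, -⟩ T' - heq
    simp only [addChild, node.injEq, Nat.add_right_cancel_iff] at heq
    obtain ⟨rfl, rfl, heq⟩ := heq
    have heq := Fin.snoc_injective2 (eq_of_heq heq)
    exact ⟨by rw [heq.1], heq.2⟩
  · rintro _ ⟨h, m, c, rfl, hhm, hc⟩ -
    obtain ⟨h', m', rfl, rfl, hhm'⟩ := (hp' _ _).1 hhm
    obtain ⟨h2, hd, hm2⟩ := hp h' m' hhm'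
    refine ⟨node h' m' (Fin.init c), ⟨_, _, _, rfl, hhm', fun i => hc _⟩, c (Fin.last _), hc _,
      ⟨by omega, by omega, by omega, fun i => (hc _).isProper⟩, (hc _).isProper, ?_⟩
    rw [addChild, Fin.snoc_init_self]

theorem treeSeries_rootSet_two :
    treeSeries (rootSet fun h m => h = 2 ∧ m = 2) =
      y ^ 1 * q ^ 1 * (treeSeries {T | T.IsNormal} * treeSeries {T | T.IsNormal}) := by
  refine treeSeries_image2 (bin 2) 1 1 ?_ ?_ ?_
  · intro S hS T hT hS' hT'
    refine ⟨⟨2, 2, _, rfl, ⟨rfl, rfl⟩, fun i => ?_⟩, hS'.bin (Or.inr rfl) hT',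
      by simp [bin, numLeaves], ?_, ?_⟩
    · fin_cases i
      · exact hS
      · exact hT
    · simp [bin, sumHelicity]
    · simp [bin, sumVertexDim, vertexDim]
  · intro S _ T _ S' _ T' _ heq
    simp only [bin, node.injEq, heq_eq_eq, true_and] at heq
    exact ⟨congrFun heq 0, congrFun heq 1⟩
  · rintro _ ⟨_, _, c, rfl, ⟨rfl, rfl⟩, hc⟩ -
    refine ⟨c 0, hc 0, c 1, hc 1, (hc 0).isProper, (hc 1).isProper, ?_⟩
    rw [bin]
    congr 1
    funext i
    fin_cases i <;> rfl

theorem treeSeries_rootSet_union {p p₁ p₂ : ℕ → ℕ → Prop} (h : ∀ a b, p a b ↔ p₁ a b ∨ p₂ a b)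
    (h' : ∀ a b, p₁ a b → ¬ p₂ a b) :
    treeSeries (rootSet p) = treeSeries (rootSet p₁) + treeSeries (rootSet p₂) := by
  refine treeSeries_union (fun T _ => ?_) ?_
  · constructor
    · rintro ⟨a, b, c, rfl, hp, hc⟩
      exact ((h a b).1 hp).imp (fun hp => ⟨a, b, c, rfl, hp, hc⟩) fun hp => ⟨a, b, c, rfl, hp, hc⟩
    · rintro (⟨a, b, c, rfl, hp, hc⟩ | ⟨a, b, c, rfl, hp, hc⟩)
      · exact ⟨a, b, c, rfl, (h a b).2 (Or.inl hp), hc⟩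
      · exact ⟨a, b, c, rfl, (h a b).2 (Or.inr hp), hc⟩
  · rintro _ ⟨a, b, c, rfl, hp, -⟩ ⟨a', b', c', heq, hp', -⟩
    cases heq
    exact h' a b hp hp'

theorem treeSeries_leaf : treeSeries {leaf} = x := by
  ext1 n
  rw [x, PowerSeries.coeff_X, treeSeries, PowerSeries.coeff_mk]
  have hl : ∀ T, T ∈ level {leaf} n ↔ T = leaf ∧ n = 1 := fun T => by
    rw [mem_level]
    constructor
    · rintro ⟨-, h1, rfl⟩
      exact ⟨rfl, h1.symm⟩
    · rintro ⟨rfl, rfl⟩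
      exact ⟨trivial, rfl, rfl⟩
  split_ifs with hn
  · rw [show level {leaf} n = {leaf} by
      ext T; rw [hl, mem_singleton, and_iff_left hn]]
    simp [weight, monomialYQ, sumHelicity, sumVertexDim]
  · rw [show level {leaf} n = ∅ by
      refine Finset.eq_empty_iff_forall_notMem.2 fun T hT => hn ((hl T).1 hT).2]
    rfl

theorem treeSeries_normal_eq_sum :
    treeSeries {T | T.IsNormal} = x + (treeSeries (colourSet 1) + (treeSeries (colourSet 2) +
      treeSeries (rootSet fun h m => 2 ≤ h ∧ h + 1 ≤ m))) := by
  have hgen : ∀ h m (c : Fin m → PlaneTree), 2 ≤ h → h + 1 ≤ m → (∀ i, (c i).IsNormal) →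
      (node h m c).IsNormal := fun h m c h2 hm hc =>
    ⟨by omega, by omega, by omega, fun k hk => by
      rcases hk with ⟨-, hk⟩ | ⟨-, hk⟩ <;> omega, hc⟩
  rw [← treeSeries_leaf, ← treeSeries_union (A := colourSet 2)
    (C := {T | T.IsNormal ∧ T ≠ leaf ∧ ¬ T.HasColour 1}), ← treeSeries_union (A := colourSet 1)
    (C := {T | T.IsNormal ∧ T ≠ leaf}), ← treeSeries_union (A := {leaf})]
  · intro T _
    by_cases hT : T = leaf
    · subst hT
      simp [IsNormal]
    · simp [hT]
  · rintro T rfl ⟨-, h⟩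
    exact h rfl
  · intro T _
    by_cases hT : T.HasColour 1
    · have : T ≠ leaf := by rintro rfl; exact hT
      simp [colourSet, hT, this]
    · simp [colourSet, hT]
  · rintro T ⟨-, h⟩ ⟨-, -, h'⟩
    exact h' h
  · intro T _
    constructor
    · rintro ⟨hN, hne, hk⟩
      by_cases hT : T.HasColour 2
      · exact Or.inl ⟨hN, hT⟩
      · right
        rcases T with _ | ⟨h, m, c⟩
        · exact absurd rfl hne
        · have h1 : h ≠ 1 := fun h1 => hk (Or.inl ⟨rfl, h1⟩)
          have h2 : h ≠ m := fun h2 => hT (Or.inr ⟨rfl, h2⟩)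
          obtain ⟨-, h3, h4, -, hc⟩ := hN
          exact ⟨h, m, c, rfl, ⟨by omega, by omega⟩, hc⟩
    · rintro (⟨hN, hT⟩ | ⟨h, m, c, rfl, ⟨h2, hm⟩, hc⟩)
      · refine ⟨hN, by rintro rfl; exact hT, fun h1 => ?_⟩
        obtain ⟨a, b, rfl⟩ := hN.eq_bin hT
        rcases h1 with ⟨-, h1⟩ | ⟨h1, -⟩ <;> omega
      · refine ⟨hgen h m c h2 hm hc, by simp, ?_⟩
        rintro (⟨-, hk⟩ | ⟨hk, -⟩) <;> omega
  · rintro T ⟨-, hT⟩ ⟨h, m, c, rfl, ⟨h2, hm⟩, hc⟩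
    rcases hT with ⟨hk, -⟩ | ⟨-, hk⟩ <;> omega

/-- Generic roots are generated by two geometric series: from `h = m = 2`, children are added at
constant helicity to reach `h = 2`, `m ≥ 3`, and then children that also raise the helicity.
Eliminating the auxiliary series gives the equation. -/
theorem treeSeries_normal_functional_equation {F : GF} (hF : F = treeSeries {T | T.IsNormal}) :
    F * (1 - F * (1 + y) * q ^ 2 - F ^ 2 * y * q ^ 2 * (1 + q - q ^ 2)
      - F ^ 4 * y ^ 2 * q ^ 5 * (1 + q)) =
    x * ((1 + F * q) * (1 + F * y * q) * (1 - F * q ^ 2) * (1 - F * y * q ^ 2)) := by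
  have e1 := treeSeries_colourSet (k := 1) (Or.inl rfl)
  have e2 := treeSeries_colourSet (k := 2) (Or.inr rfl)
  have f1 := treeSeries_normal_eq_colour_add 1
  have f2 := treeSeries_normal_eq_colour_add 2
  have g0 := treeSeries_normal_eq_sum
  have g1 := treeSeries_rootSet_two
  have g2 := treeSeries_rootSet_union (p := fun h m => h = 2 ∧ 2 ≤ m)
    (p₁ := fun h m => h = 2 ∧ m = 2) (p₂ := fun h m => h = 2 ∧ 3 ≤ m)
    (fun a b => by omega) (fun a b => by omega)
  have g3 := treeSeries_rootSet_union (p := fun h m => 2 ≤ h ∧ h + 1 ≤ m)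
    (p₁ := fun h m => h = 2 ∧ 3 ≤ m) (p₂ := fun h m => 3 ≤ h ∧ h + 1 ≤ m)
    (fun a b => by omega) (fun a b => by omega)
  have g4 := treeSeries_addChild 0 (p := fun h m => h = 2 ∧ 2 ≤ m)
    (p' := fun h m => h = 2 ∧ 3 ≤ m) (fun h m => by omega) (fun h m =>
      ⟨fun hp => ⟨h, m - 1, by omega, by omega, by omega, by omega⟩, by
        rintro ⟨h', m', rfl, rfl, h1, h2⟩; omega⟩)
  have g5 := treeSeries_addChild 1 (p := fun h m => 2 ≤ h ∧ h + 1 ≤ m)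
    (p' := fun h m => 3 ≤ h ∧ h + 1 ≤ m) (fun h m => by omega) (fun h m =>
      ⟨fun hp => ⟨h - 1, m - 1, by omega, by omega, by omega, by omega⟩, by
        rintro ⟨h', m', rfl, rfl, h1, h2⟩; omega⟩)
  rw [← hF] at e1 e2 f1 f2 g0 g1 g4 g5
  generalize treeSeries (colourSet 1) = W at *
  generalize treeSeries (colourSet 2) = B at *
  generalize treeSeries (noColourSet 1) = W' at *
  generalize treeSeries (noColourSet 2) = B' at *
  generalize treeSeries (rootSet fun h m => h = 2 ∧ m = 2) = P at *
  generalize treeSeries (rootSet fun h m => h = 2 ∧ 2 ≤ m) = X at *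
  generalize treeSeries (rootSet fun h m => h = 2 ∧ 3 ≤ m) = X₀ at *
  generalize treeSeries (rootSet fun h m => 2 ≤ h ∧ h + 1 ≤ m) = X₁ at *
  generalize treeSeries (rootSet fun h m => 3 ≤ h ∧ h + 1 ≤ m) = X₂ at *
  clear hF
  norm_num at e1 e2 g4 g5
  have hW : W * (1 + F * q) = q * F ^ 2 := by
    linear_combination e1 - q * F * f1
  have hB : B * (1 + F * y * q) = y * q * F ^ 2 := by
    linear_combination e2 - y * q * F * f2
  have hX₀ : X₀ * (1 - F * q ^ 2) = y * q ^ 3 * F ^ 3 := by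
    linear_combination g4 + q ^ 2 * F * g2 + q ^ 2 * F * g1
  have hX₁ : X₁ * (1 - F * y * q ^ 2) = X₀ := by
    linear_combination g3 + g5
  have hx : x = F - W - B - X₁ := by linear_combination -g0
  rw [hx]
  linear_combination (1 + F * y * q) * (1 - F * q ^ 2) * (1 - F * y * q ^ 2) * hW +
    (1 + F * q) * (1 - F * q ^ 2) * (1 - F * y * q ^ 2) * hB +
    (1 + F * q) * (1 + F * y * q) * (1 - F * q ^ 2) * hX₁ +
    (1 + F * q) * (1 + F * y * q) * hX₀

end PlaneTree

end GrassmannianTree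
-- The compositional inverse and its coefficients
namespace GrassmannianTree

open Finset PlaneTree

theorem constantCoeff_treeSeries_normal :
    PowerSeries.constantCoeff (treeSeries {T | T.IsNormal}) = 0 := by
  rw [← PowerSeries.coeff_zero_eq_constantCoeff_apply, treeSeries, PowerSeries.coeff_mk]
  refine sum_eq_zero fun T hT => ?_
  obtain ⟨h1, h2, -⟩ := mem_level.1 hT
  have := h1.one_le_numLeaves
  omega

theorem subst_seriesC_eq_X {F : GF} (hF0 : PowerSeries.constantCoeff F = 0)
    (hF : F * (1 - F * (1 + y) * q ^ 2 - F ^ 2 * y * q ^ 2 * (1 + q - q ^ 2)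
        - F ^ 4 * y ^ 2 * q ^ 5 * (1 + q)) =
      x * ((1 + F * q) * (1 + F * y * q) * (1 - F * q ^ 2) * (1 - F * y * q ^ 2))) :
    seriesC.subst F = PowerSeries.X := by
  have hs : PowerSeries.HasSubst F := PowerSeries.HasSubst.of_constantCoeff_zero' hF0
  have hC : ∀ r, PowerSeries.substAlgHom hs (PowerSeries.C r) = (PowerSeries.C r : GF) := fun r => by
    rw [PowerSeries.coe_substAlgHom hs]
    exact PowerSeries.subst_C r
  have hX : PowerSeries.substAlgHom hs (x : GF) = F := PowerSeries.substAlgHom_X hs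
  have hy : PowerSeries.substAlgHom hs (y : GF) = y := hC _
  have hq : PowerSeries.substAlgHom hs (q : GF) = q := hC _
  have hmul : seriesC * denC = numC := by
    rw [seriesC, mul_assoc, mul_comm _ denC, denC_mul_invOfUnit, mul_one]
  have h := congrArg (PowerSeries.substAlgHom hs) hmul
  simp only [map_mul, map_sub, map_add, map_one, map_pow, numC, denC, hX, hy, hq] at h
  rw [hF] at h
  -- The constant coefficient is `1` because `F` has none; the denominator can then be cancelled in
  -- a domain.
  have hne : (1 + F * q) * (1 + F * y * q) * (1 - F * q ^ 2) * (1 - F * y * q ^ 2) ≠ 0 := by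
    intro h0
    have := congrArg (PowerSeries.constantCoeff) h0
    simp [hF0] at this
  rw [← PowerSeries.coe_substAlgHom hs]
  exact mul_right_cancel₀ hne h

theorem inverseC_eq_treeSeries : inverseC = treeSeries {T | T.IsNormal} := by
  set F := treeSeries {T | T.IsNormal} with hF
  have hF0 : PowerSeries.constantCoeff F = 0 := constantCoeff_treeSeries_normal
  have hs : PowerSeries.HasSubst F := PowerSeries.HasSubst.of_constantCoeff_zero' hF0
  have hsC : PowerSeries.HasSubst seriesC :=
    PowerSeries.HasSubst.of_constantCoeff_zero' constantCoeff_seriesC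
  have h1 := subst_seriesC_eq_X hF0 (treeSeries_normal_functional_equation hF)
  have h2 : inverseC.subst seriesC = PowerSeries.X :=
    PowerSeries.subst_substInvOfIsUnit_left _ constantCoeff_seriesC _
  have h3 := PowerSeries.subst_comp_subst_apply hsC hs inverseC
  -- Substituting `F` into `C⁻¹(C(x)) = x` gives `F = C⁻¹(C(F)) = C⁻¹(x)`: a right inverse of `C`
  -- equals its left inverse.
  rw [h1, h2, PowerSeries.subst_X hs] at h3
  rw [h3, ← PowerSeries.map_algebraMap_eq_subst_X, Algebra.algebraMap_self, PowerSeries.map_id]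
  rfl

theorem coeffXYQ_treeGF_of_ne_one {n : ℕ} (hn : n ≠ 1) (k r : ℕ) :
    coeffXYQ n k r treeGF = (Set.ncard {T : PlaneTree | T.IsNormal ∧ T.numLeaves + 1 = n ∧
      T.sumHelicity + 1 = k ∧ T.sumVertexDim + 1 = r} : ℤ) := by
  rw [coeffXYQ, treeGF, inverseC_eq_treeSeries, x]
  rcases n with _ | n
  · simp
  · have hn0 : n ≠ 0 := by omega
    have hyq : (y * q : GF) = PowerSeries.C (monomialYQ 1 1) := by
      rw [C_monomialYQ, pow_one, pow_one]
    have hset : {T : PlaneTree | T.IsNormal ∧ T.numLeaves + 1 = n + 1 ∧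
        T.sumHelicity + 1 = k ∧ T.sumVertexDim + 1 = r} =
        ((level {T | T.IsNormal} n).filter fun T =>
          1 + T.sumHelicity = k ∧ 1 + T.sumVertexDim = r : Finset PlaneTree) := by
      ext T
      simp only [Set.mem_ofPred_eq, coe_filter, mem_level, Nat.add_right_cancel_iff, add_comm 1]
      exact ⟨fun h => ⟨⟨h.1.isProper, h.2.1, h.1⟩, h.2.2⟩, fun h => ⟨h.1.2.2, h.1.2.1, h.2⟩⟩
    rw [PowerSeries.coeff_succ_X_mul, map_add, map_add, PowerSeries.coeff_one, if_neg hn0, y,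
      PowerSeries.coeff_C, if_neg hn0, ← y, hyq, PowerSeries.coeff_C_mul, treeSeries,
      PowerSeries.coeff_mk, mul_sum, hset, Set.ncard_coe_finset, card_filter]
    simp only [weight, monomialYQ_mul, zero_add, Polynomial.finsetSum_coeff,
      coeff_coeff_monomialYQ]
    push_cast
    rfl

theorem coeffXYQ_one_treeGF (k r : ℕ) :
    coeffXYQ 1 k r treeGF = if r = 0 ∧ k ≤ 1 then 1 else 0 := by
  have h0 : PowerSeries.constantCoeff inverseC = 0 := by
    rw [inverseC_eq_treeSeries, constantCoeff_treeSeries_normal]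
  rw [coeffXYQ, treeGF, x, PowerSeries.coeff_succ_X_mul]
  simp only [PowerSeries.coeff_zero_eq_constantCoeff, map_add, map_mul, h0, mul_zero, add_zero,
    map_one, y, PowerSeries.constantCoeff_C]
  rcases r with _ | r
  · rcases k with _ | _ | k
    · simp
    · simp [Polynomial.coeff_one]
    · simp [Polynomial.coeff_one, Polynomial.coeff_X]
  · simp [Polynomial.coeff_one]

end GrassmannianTree

theorem mainTheorem7 :
    (∀ (n : ℕ) (w : GrassmannianTree.DecoratedPerm n),
      GrassmannianTree.IsGrassmannianTreePerm w → ∃! r : ℕ, GrassmannianTree.HasMomDim w r) ∧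
    ∀ n k r : ℕ,
      (Set.ncard {w : GrassmannianTree.DecoratedPerm n |
        GrassmannianTree.IsGrassmannianTreePerm w ∧ w.antiexcedances.card = k ∧
          GrassmannianTree.HasMomDim w r} : ℤ) =
        GrassmannianTree.coeffXYQ n k r GrassmannianTree.treeGF := by
  refine ⟨fun n w hw => GrassmannianTree.existsUnique_hasMomDim hw, fun n k r => ?_⟩
  by_cases hn : n = 1
  · subst hn
    rw [GrassmannianTree.ncard_one, GrassmannianTree.coeffXYQ_one_treeGF]
    push_cast
    rfl
  · rw [GrassmannianTree.ncard_eq_ncard_normal hn, GrassmannianTree.coeffXYQ_treeGF_of_ne_one hn]
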